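/- **Setting.** Let $U\subset\mathbb R^4$ be an open coordinate domain (indices $0,\dots,3$, summation convention, comma = partial derivative) and let $g_{ij}$ be a smooth non-symmetric metric on $U$ with symmetric part $g_{\underline{ij}}=\frac12(g_{ij}+g_{ji})$ and anti-symmetric part $\frac12(g_{ij}-g_{ji})$. Assume $g=\det[g_{\underline{ij}}]\ne 0$ on $U$, and let $[g^{\underline{ij}}]=[g_{\underline{ij}}]^{-1}$. Put $$\Gamma^i_{jk}=\tfrac12 g^{\underline{i\alpha}}(g_{j\alpha,k}-g_{jk,\alpha}+g_{\alpha k,j}),\qquad T^i_{jk}=\Gamma^i_{jk}-\Gamma^i_{kj},\qquad T_{ijk}=g_{\underline{i\alpha}}T^\alpha_{jk}.$$ Let $|$ be the covariant derivative of the symmetric part of $\Gamma$ (the Levi-Civita connection of $g_{\underline{ij}}$), and $R^i_{jmn}$, $R_{ij}=R^\alpha_{ij\alpha}$, $R=g^{\underline{ij}}R_{ij}$ its curvatures, with the convention $R^i_{jmn}=\Gamma^i_{\underline{jm},n}-\Gamma^i_{\underline{jn},m}+\Gamma^\alpha_{\underline{jm}}\Gamma^i_{\underline{\alpha n}}-\Gamma^\alpha_{\underline{jn}}\Gamma^i_{\underline{\alpha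 m}}$. For real coefficients $u,u',v,v',w$ put $$K^i_{jmn}=R^i_{jmn}+uT^i_{jm|n}+u'T^i_{jn|m}+vT^\alpha_{jm}T^i_{\alpha n}+v'T^\alpha_{jn}T^i_{\alpha m}+wT^\alpha_{mn}T^i_{\alpha j},\quad K_{ij}=K^\alpha_{ij\alpha},\quad K=g^{\underline{ij}}K_{ij}.$$ The torsion square and the tensor $\tau$ are $$\mathcal Q=g^{\underline{\gamma\delta}}T^\alpha_{\gamma\beta}T^\beta_{\delta\alpha}=g^{\underline{\gamma\delta}}g^{\underline{\alpha\epsilon}}g^{\underline{\beta\zeta}}T_{\epsilon\gamma\beta}T_{\zeta\delta\alpha},\qquad \tau_{ij}=\frac{\delta g^{\underline{\gamma\delta}}}{\delta g^{\underline{ij}}}\,g^{\underline{\alpha\epsilon}}g^{\underline{\beta\zeta}}T_{\epsilon\gamma\beta}T_{\zeta\delta\alpha},\qquad \frac{\delta g^{\underline{\gamma\delta}}}{\delta g^{\underline{ij}}}=\tfrac12(\delta^\gamma_i\delta^\delta_j+\delta^\gamma_j\delta^\delta_i).$$ **Variations.** An admissible variation is a smooth symmetric field $h^{ij}=\delta g^{\underline{ij}}$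 vanishing outside a compact set $D\subset U$; it replaces $g^{\underline{ij}}$ by $g^{\underline{ij}}+sh^{ij}$. The anti-symmetric part of the metric is given as a functional of $g^{\underline{ij}}$ (for instance a constant one), smooth jointly in $s$ and the point along admissible variations; the varied metric is formed with it, and its torsion is written $T^{(s)}$. Assume that the variational derivative $\mathcal W_{ij}=g^{\underline{\gamma\delta}}g^{\underline{\alpha\epsilon}}g^{\underline{\beta\zeta}}T_{\zeta\delta\alpha}\,\delta T_{\epsilon\gamma\beta}/\delta g^{\underline{ij}}$ exists as a continuous symmetric field on $U$, i.e. for all $D$ and $h$ $$\frac{d}{ds}\Big|_{s=0}\int_D\sqrt{|g|}\,g^{\underline{\gamma\delta}}g^{\underline{\alpha\epsilon}}g^{\underline{\beta\zeta}}T_{\zeta\delta\alpha}T^{(s)}_{\epsilon\gamma\beta}\,d^4x=\int_D\sqrt{|g|}\,\mathcal W_{ij}h^{ij}\,d^4x .$$ For a constant $\Lambda$ let $S=\int_D\sqrt{|g|}\,(K-2\Lambda)\,d^4x$. A continuous symmetric field $T_{ij}$ on $U$ is called the energy-momentum tensor resulting from $S$ if for all $D$ and $h$ $$\delta S=\int_D\sqrt{|g|}\,\big(R_{ij}-\tfrac12Rg_{\underline{ij}}+\Lambda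 g_{\underline{ij}}-T_{ij}\big)\,\delta g^{\underline{ij}}\,d^4x .$$ For a vector $u^i$ with $g_{\underline{ij}}u^iu^j=1$ put $\rho=T_{\alpha\beta}u^\alpha u^\beta$, $p=-\frac13T^\alpha_\alpha+\frac13T_{\alpha\beta}u^\alpha u^\beta$, $\omega=p\rho^{-1}$. In the comoving frame $u^i=\delta^i_0$ (so $g_{\underline{00}}=1$) put $\rho_0=T_{00}$, $p_0=-\frac13T^\alpha_\alpha+\frac13T_{00}$, $\omega_0=p_0\rho_0^{-1}$. **Theorem.** For all coefficients $u,u',v,v',w$ and all $\Lambda$ the following hold at every point of $U$. 1. $K=R-(v'+w)\mathcal Q$. 2. $S$ is stationary under all admissible variations if and only if on $U$ $$R_{ij}-\tfrac12Rg_{\underline{ij}}+\Lambda g_{\underline{ij}}=(v'+w)\big(3\tau_{ij}+2\mathcal W_{ij}-\tfrac12\mathcal Q\,g_{\underline{ij}}\big).$$ 3. There is exactly one energy-momentum tensor on $U$ resulting from $S$. It and its trace are $$T_{ij}=(v'+w)\big(3\tau_{ij}+2\mathcal W_{ij}-\tfrac12\mathcal Q\,g_{\underline{ij}}\big),\qquad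 T^\alpha_\alpha=(v'+w)\big(3\tau^\alpha_\alpha+2\mathcal W^\alpha_\alpha-2\mathcal Q\big).$$ 4. The pressures and energy-densities are $$p=-\tfrac13(v'+w)\big[3\tau^\alpha_\alpha+2\mathcal W^\alpha_\alpha-\tfrac32\mathcal Q-(3\tau_{\alpha\beta}+2\mathcal W_{\alpha\beta})u^\alpha u^\beta\big],\quad p_0=-\tfrac13(v'+w)\big(3\tau^\alpha_\alpha+2\mathcal W^\alpha_\alpha-\tfrac32\mathcal Q-3\tau_{00}-2\mathcal W_{00}\big),$$ $$\rho=(v'+w)\big[(3\tau_{\alpha\beta}+2\mathcal W_{\alpha\beta})u^\alpha u^\beta-\tfrac12\mathcal Q\big],\qquad \rho_0=(v'+w)\big[3\tau_{00}+2\mathcal W_{00}-\tfrac12\mathcal Q\big].$$ 5. The state parameters do not depend on the coefficients: for any two choices of $(u,u',v,v',w)$ (and of $\Lambda$) with both energy-densities $\rho$ non-zero (respectively both $\rho_0$ non-zero) at the point, the values of $\omega$ (respectively $\omega_0$) coincide. -/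

import Mathlib

open scoped ContDiff

noncomputable section

namespace GenRiem

/-- Points of a coordinate domain of the four-dimensional manifold. Indices run over `0, 1, 2, 3`. -/
abbrev Coord : Type := Fin 4 → ℝ

/-- Component arrays of tensors with two indices, as functions of the coordinates. -/
abbrev Field2 : Type := Coord → Matrix (Fin 4) (Fin 4) ℝ

/-- Partial derivative with respect to the `k`-th coordinate. -/
def pd (k : Fin 4) (f : Coord → ℝ) (x : Coord) : ℝ :=
  fderiv ℝ f x (Pi.single k 1)

/-- Symmetric part of the metric. -/
def symPart (g : Field2) : Field2 := fun x => (1 / 2 : ℝ) • (g x + (g x).transpose)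

/-- Anti-symmetric part of the metric. -/
def skewPart (g : Field2) : Field2 := fun x => (1 / 2 : ℝ) • (g x - (g x).transpose)

/-- Contravariant symmetric part: the inverse matrix of the symmetric part. -/
def gInv (g : Field2) : Field2 := fun x => (symPart g x)⁻¹

/-- Volume density `√|det(symmetric part)|`. -/
def volDensity (g : Field2) (x : Coord) : ℝ := Real.sqrt |(symPart g x).det|

/-- Generalized Christoffel symbols `Γ^i_{jk}` of the second kind of the non-symmetric metric. -/
def christoffel (g : Field2) (i j k : Fin 4) (x : Coord) : ℝ :=
  (1 / 2) * ∑ a, gInv g x i a *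
    (pd k (fun y => g y j a) x - pd a (fun y => g y j k) x + pd j (fun y => g y a k) x)

/-- Symmetric part of the connection: the Christoffel symbols of the associated space. -/
def christoffelSym (g : Field2) (i j k : Fin 4) (x : Coord) : ℝ :=
  (1 / 2) * (christoffel g i j k x + christoffel g i k j x)

/-- Anti-symmetric part of the connection. -/
def christoffelSkew (g : Field2) (i j k : Fin 4) (x : Coord) : ℝ :=
  (1 / 2) * (christoffel g i j k x - christoffel g i k j x)

/-- Torsion tensor `T^i_{jk}`. -/
def torsion (g : Field2) (i j k : Fin 4) (x : Coord) : ℝ := 2 * christoffelSkew g i j k x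

/-- Covariant torsion tensor `T_{ijk} = g_{ia} T^a_{jk}`, the metric being the symmetric part. -/
def torsionLow (g : Field2) (x : Coord) (i j k : Fin 4) : ℝ :=
  ∑ a, symPart g x i a * torsion g a j k x

/-- Covariant derivative `T^i_{jk|n}` with respect to the associated space. -/
def torsionCov (g : Field2) (i j k n : Fin 4) (x : Coord) : ℝ :=
  pd n (torsion g i j k) x
    + ∑ a, christoffelSym g i a n x * torsion g a j k x
    - ∑ a, christoffelSym g a j n x * torsion g i a k x
    - ∑ a, christoffelSym g a k n x * torsion g i j a x

/-- Curvature tensor `R^i_{jmn}` of the associated space. -/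
def riemann (g : Field2) (i j m n : Fin 4) (x : Coord) : ℝ :=
  pd n (christoffelSym g i j m) x - pd m (christoffelSym g i j n) x
    + ∑ a, christoffelSym g a j m x * christoffelSym g i a n x
    - ∑ a, christoffelSym g a j n x * christoffelSym g i a m x

/-- Ricci tensor `R_{ij} = R^a_{ija}` of the associated space. -/
def ricci (g : Field2) (i j : Fin 4) (x : Coord) : ℝ := ∑ a, riemann g a i j a x

/-- Scalar curvature of the associated space. -/
def scalarCurv (g : Field2) (x : Coord) : ℝ := ∑ i, ∑ j, gInv g x i j * ricci g i j x

/-- The coefficients of the family of curvature tensors. -/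
structure Coeffs where
  u : ℝ
  u' : ℝ
  v : ℝ
  v' : ℝ
  w : ℝ

/-- The family of curvature tensors `K^i_{jmn}` of the generalized Riemannian space. -/
def curvFamily (c : Coeffs) (g : Field2) (i j m n : Fin 4) (x : Coord) : ℝ :=
  riemann g i j m n x
    + c.u * torsionCov g i j m n x
    + c.u' * torsionCov g i j n m x
    + c.v * ∑ a, torsion g a j m x * torsion g i a n x
    + c.v' * ∑ a, torsion g a j n x * torsion g i a m x
    + c.w * ∑ a, torsion g a m n x * torsion g i a j x

/-- The family of Ricci curvatures `K_{ij} = K^a_{ija}`. -/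
def ricciFamily (c : Coeffs) (g : Field2) (i j : Fin 4) (x : Coord) : ℝ :=
  ∑ a, curvFamily c g a i j a x

/-- The family of scalar curvatures `K = g^{ij} K_{ij}`. -/
def scalarFamily (c : Coeffs) (g : Field2) (x : Coord) : ℝ :=
  ∑ i, ∑ j, gInv g x i j * ricciFamily c g i j x

/-- The pairing `P^{cd} P^{ae} P^{bz} T_{ecb} S_{zda}` of two covariant arrays with three
indices. -/
def torsionPair (P : Matrix (Fin 4) (Fin 4) ℝ) (T S : Fin 4 → Fin 4 → Fin 4 → ℝ) : ℝ :=
  ∑ c, ∑ d, ∑ a, ∑ e, ∑ b, ∑ z, P c d * P a e * P b z * T e c b * S z d a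

/-- The torsion square `g^{cd} T^a_{cb} T^b_{da} = g^{cd} g^{ae} g^{bz} T_{ecb} T_{zda}`. -/
def torsionSq (g : Field2) (x : Coord) : ℝ :=
  torsionPair (gInv g x) (torsionLow g x) (torsionLow g x)

/-- `δg^{cd} / δg^{ij}` for symmetric `g^{ij}`. -/
def symDelta (c d i j : Fin 4) : ℝ :=
  (1 / 2) * ((if c = i ∧ d = j then 1 else 0) + (if c = j ∧ d = i then 1 else 0))

/-- `τ_{ij} = (δg^{cd} / δg^{ij}) g^{ae} g^{bz} T_{ecb} T_{zda}`. -/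
def tau (g : Field2) (i j : Fin 4) (x : Coord) : ℝ :=
  ∑ c, ∑ d, ∑ a, ∑ e, ∑ b, ∑ z,
    symDelta c d i j * gInv g x a e * gInv g x b z * torsionLow g x e c b * torsionLow g x z d a

/-- An admissible variation `h^{ij} = δg^{ij}`: symmetric, smooth and vanishing outside `D`. -/
structure IsVariation (D : Set Coord) (h : Field2) : Prop where
  symm : ∀ x, (h x).transpose = h x
  smooth : ∀ i j, ContDiff ℝ ∞ (fun x => h x i j)
  vanish : ∀ x, x ∉ D → h x = 0

/-- The non-symmetric metric whose symmetric part has the inverse `g^{ij} + s h^{ij}`. The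
anti-symmetric part is a functional `A` of the contravariant symmetric part (a constant functional
if the anti-symmetric part is held fixed). -/
def varied (g : Field2) (A : Field2 → Field2) (h : Field2) (s : ℝ) : Field2 :=
  fun x => (gInv g x + s • h x)⁻¹ + A (fun y => gInv g y + s • h y) x

/-- `A` prescribes, smoothly along admissible variations, the anti-symmetric part of the metric as
a functional of the contravariant symmetric part, and at `g` itself it gives the anti-symmetric part
of `g`. -/
structure IsSkewRule (U : Set Coord) (g : Field2) (A : Field2 → Field2) : Prop where
  base : ∀ x ∈ U, A (gInv g) x = skewPart g x
  along : ∀ (D : Set Coord) (h : Field2), IsCompact D → D ⊆ U → IsVariation D h →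
    ∃ r : ℝ, 0 < r ∧
      (∀ s ∈ Set.Ioo (-r) r, ∀ x ∈ U,
        (A (fun y => gInv g y + s • h y) x).transpose = -A (fun y => gInv g y + s • h y) x) ∧
      ∀ i j, ContDiffOn ℝ ∞
        (fun q : ℝ × Coord => A (fun y => gInv g y + q.1 • h y) q.2 i j)
        (Set.Ioo (-r) r ×ˢ U)

/-- `W_{ij} = g^{cd} g^{ae} g^{bz} T_{zda} (δT_{ecb} / δg^{ij})`: the continuous symmetric field
that represents the variational derivative, with respect to `g^{ij}`, of the torsion functional
`T_{ecb}` contracted with the fixed quantities `√|g| g^{cd} g^{ae} g^{bz} T_{zda}`. -/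
structure IsTorsionVariation (U : Set Coord) (g : Field2) (A : Field2 → Field2)
    (W : Field2) : Prop where
  symm : ∀ x ∈ U, (W x).transpose = W x
  cont : ∀ i j, ContinuousOn (fun x => W x i j) U
  deriv : ∀ (D : Set Coord) (h : Field2), IsCompact D → D ⊆ U → IsVariation D h →
    HasDerivAt
      (fun s : ℝ => ∫ x in D, volDensity g x *
        torsionPair (gInv g x) (torsionLow (varied g A h s) x) (torsionLow g x))
      (∫ x in D, volDensity g x * ∑ i, ∑ j, W x i j * h x i j) 0

/-- The Einstein–Hilbert action `∫ √|g| (K - 2Λ)` over the region `D`. -/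
def action (c : Coeffs) (Lam : ℝ) (D : Set Coord) (g : Field2) : ℝ :=
  ∫ x in D, volDensity g x * (scalarFamily c g x - 2 * Lam)

/-- The left side `R_{ij} - R g_{ij} / 2 + Λ g_{ij}` of the equations of motion. -/
def einsteinLam (g : Field2) (Lam : ℝ) (i j : Fin 4) (x : Coord) : ℝ :=
  ricci g i j x - (1 / 2) * scalarCurv g x * symPart g x i j + Lam * symPart g x i j

/-- The action is stationary at `g` under all admissible variations of `g^{ij}`. -/
def IsStationary (U : Set Coord) (g : Field2) (A : Field2 → Field2) (c : Coeffs)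
    (Lam : ℝ) : Prop :=
  ∀ (D : Set Coord) (h : Field2), IsCompact D → D ⊆ U → IsVariation D h →
    HasDerivAt (fun s : ℝ => action c Lam D (varied g A h s)) 0 0

/-- `T_{ij}` is the energy-momentum tensor that results from the action, that is,
`δS = ∫ √|g| (R_{ij} - R g_{ij} / 2 + Λ g_{ij} - T_{ij}) δg^{ij}`. -/
structure IsEnergyMomentum (U : Set Coord) (g : Field2) (A : Field2 → Field2) (c : Coeffs)
    (Lam : ℝ) (T : Field2) : Prop where
  symm : ∀ x ∈ U, (T x).transpose = T x
  cont : ∀ i j, ContinuousOn (fun x => T x i j) U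
  deriv : ∀ (D : Set Coord) (h : Field2), IsCompact D → D ⊆ U → IsVariation D h →
    HasDerivAt (fun s : ℝ => action c Lam D (varied g A h s))
      (∫ x in D, volDensity g x * ∑ i, ∑ j, (einsteinLam g Lam i j x - T x i j) * h x i j) 0

/-- The trace `M^a_a = g^{ij} M_{ij}` at the point `x`. -/
def trace (g : Field2) (x : Coord) (M : Fin 4 → Fin 4 → ℝ) : ℝ :=
  ∑ i, ∑ j, gInv g x i j * M i j

/-- The contraction `M_{ij} u^i u^j`. -/
def contract (M : Fin 4 → Fin 4 → ℝ) (u : Fin 4 → ℝ) : ℝ := ∑ i, ∑ j, M i j * u i * u j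

/-- Energy-density `ρ = T_{ij} u^i u^j`. -/
def density (T : Field2) (u : Fin 4 → ℝ) (x : Coord) : ℝ := contract (T x) u

/-- Pressure `p = -T^a_a / 3 + T_{ij} u^i u^j / 3`. -/
def pressure (g T : Field2) (u : Fin 4 → ℝ) (x : Coord) : ℝ :=
  -(1 / 3) * trace g x (T x) + (1 / 3) * contract (T x) u

/-- State parameter `ω = p ρ⁻¹`. -/
def stateParam (g T : Field2) (u : Fin 4 → ℝ) (x : Coord) : ℝ :=
  pressure g T u x * (density T u x)⁻¹

/-- Energy-density `ρ₀ = T_{00}` in the comoving reference frame. -/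
def density0 (T : Field2) (x : Coord) : ℝ := T x 0 0

/-- Pressure `p₀ = -T^a_a / 3 + T_{00} / 3` in the comoving reference frame. -/
def pressure0 (g T : Field2) (x : Coord) : ℝ :=
  -(1 / 3) * trace g x (T x) + (1 / 3) * T x 0 0

/-- State parameter `ω₀ = p₀ ρ₀⁻¹` in the comoving reference frame. -/
def stateParam0 (g T : Field2) (x : Coord) : ℝ := pressure0 g T x * (density0 T x)⁻¹

end GenRiem

end

/-!
The torsion of the generalized Christoffel symbols, with the index lowered, is the cyclic sum of
the partial derivatives of the anti-symmetric part of the metric (`torsionLow_eq_skewCurl`), hence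
totally skew. So every trace of the torsion vanishes, the terms in `u`, `u'` and `v` disappear
from the scalar curvature, and those in `v'` and `w` both contract to `-𝒬` (`scalarFamily_eq`).

The variation of the action is computed under the integral sign on the compact set `D`
(`hasDerivAt_setIntegral_of_smoothFamily`); this is legitimate because near `{0} × D` the varied
metrics form a jointly smooth family (`exists_smoothMetricFamily_varied`). The variation has three
sources.

* `δ√|g| = -½ √|g| g_{ij} δg^{ij}`, by Jacobi's formula for the determinant.
* `√|g| g^{ij} δR_{ij}` is the divergence of a vector density built from the variation of the
  connection. This Palatini identity (`SmoothMetricFamily.sum_pd_palatiniField`) needs no formula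
  for that variation: metric compatibility of the connection, `∂_k √|g| = √|g| Γ^a_{ak}` and a
  relabelling of indices (`palatini_algebra`) suffice. The vector density vanishes off `D`, so its
  divergence integrates to zero.
* In `𝒬` the three contravariant metrics play the same role, because the torsion is totally skew,
  and each contributes `τ`; the pairing is symmetric in its two torsion factors, each of which
  contributes the variational derivative `W`.

Together these give `hasDerivAt_action`. The fundamental lemma of the calculus of variations
(`eq_zero_of_integral_variation_eq_zero`) turns it into the equations of motion and into existence
and uniqueness of the energy-momentum tensor. That lemma applies to symmetric fields only, and the
Ricci tensor is symmetric because `Γ^a_{ia}` is a logarithmic gradient (`ricci_symm`). Since the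
energy-momentum tensor is `v' + w` times a field free of the coefficients, the ratio of pressure
and energy-density does not depend on them.
-/

noncomputable section

namespace GenRiem

open MeasureTheory Filter Topology Set

/-! ### Derivatives of determinants and inverses of matrices -/

section MatrixCalculus

variable {n : Type*} [Fintype n] [DecidableEq n]

/-- Jacobi's formula for the derivative of the determinant of a curve of matrices. -/
theorem hasDerivAt_det {M : ℝ → Matrix n n ℝ} {M' : Matrix n n ℝ} {t : ℝ}
    (h : ∀ i j, HasDerivAt (fun s => M s i j) (M' i j) t) :
    HasDerivAt (fun s => (M s).det) (((M t).adjugate * M').trace) t := by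
  have h1 : HasDerivAt (fun s => (M s).det)
      (∑ σ : Equiv.Perm n, (Equiv.Perm.sign σ : ℝ) *
        ∑ i, (∏ j ∈ Finset.univ.erase i, M t (σ j) j) • M' (σ i) i) t := by
    simp only [Matrix.det_apply']
    refine HasDerivAt.fun_sum fun σ _ => HasDerivAt.const_mul _ ?_
    exact HasDerivAt.fun_finsetProd fun i _ => h (σ i) i
  convert h1 using 1
  -- Cramer's rule: the `i`-th diagonal entry is the determinant with its `i`-th column
  -- differentiated
  have h2 : ∀ i, ((M t).adjugate * M') i i
      = ∑ σ : Equiv.Perm n, (Equiv.Perm.sign σ : ℝ) *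
        ((∏ j ∈ Finset.univ.erase i, M t (σ j) j) • M' (σ i) i) := by
    intro i
    have : ((M t).adjugate * M') i i = ((M t).updateCol i (fun k => M' k i)).det := by
      rw [← Matrix.cramer_apply, Matrix.cramer_eq_adjugate_mulVec]
      rfl
    rw [this, Matrix.det_apply']
    refine Finset.sum_congr rfl fun σ _ => ?_
    rw [← Finset.prod_erase_mul _ _ (Finset.mem_univ i)]
    congr 1
    rw [smul_eq_mul]
    congr 1
    · refine Finset.prod_congr rfl fun j hj => ?_
      rw [Matrix.updateCol_ne (Finset.ne_of_mem_erase hj)]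
    · simp
  simp only [Matrix.trace, Matrix.diag_apply, h2]
  rw [Finset.sum_comm]
  simp only [Finset.mul_sum]

theorem adjugate_eq_det_smul_inv {M : Matrix n n ℝ} (h : M.det ≠ 0) :
    M.adjugate = M.det • M⁻¹ := by
  rw [Matrix.inv_def, Ring.inverse_eq_inv', smul_smul, mul_inv_cancel₀ h, one_smul]

/-- The logarithmic derivative of the volume density `√|det M|` is half of the trace of
`M⁻¹ M'`. -/
theorem hasDerivAt_sqrt_abs_det {M : ℝ → Matrix n n ℝ} {M' : Matrix n n ℝ} {t : ℝ}
    (h : ∀ i j, HasDerivAt (fun s => M s i j) (M' i j) t) (hM : (M t).det ≠ 0) :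
    HasDerivAt (fun s => Real.sqrt |(M s).det|)
      (Real.sqrt |(M t).det| * ((1 / 2) * ((M t)⁻¹ * M').trace)) t := by
  have h0 : HasDerivAt (fun s => |(M s).det|)
      (SignType.sign (M t).det * ((M t).adjugate * M').trace) t := by
    have := (hasDerivAt_abs hM).comp t (hasDerivAt_det h)
    exact this
  have h1 := h0.sqrt (abs_ne_zero.mpr hM)
  convert h1 using 1
  rw [adjugate_eq_det_smul_inv hM, Matrix.smul_mul, Matrix.trace_smul, smul_eq_mul]
  have h3 : (SignType.sign (M t).det : ℝ) * (M t).det = |(M t).det| := by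
    rcases lt_or_gt_of_ne hM with hneg | hpos
    · simp [sign_neg hneg, abs_of_neg hneg]
    · simp [sign_pos hpos, abs_of_pos hpos]
  have h4 : Real.sqrt |(M t).det| ≠ 0 := by
    rw [Real.sqrt_ne_zero']; exact abs_pos.mpr hM
  rw [← mul_assoc (SignType.sign (M t).det : ℝ), h3]
  have h5 := Real.mul_self_sqrt (abs_nonneg (M t).det)
  set r := Real.sqrt |(M t).det|
  rw [← h5]
  field_simp

/-- The derivative `-M⁻¹ M' M⁻¹` of the inverse, obtained by differentiating `M M⁻¹ = 1` once the
entries of `M⁻¹` are known to be differentiable. -/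
theorem hasDerivAt_inv_matrix {M : ℝ → Matrix n n ℝ} {M' : Matrix n n ℝ} {t : ℝ}
    (h : ∀ i j, HasDerivAt (fun s => M s i j) (M' i j) t) (hM : (M t).det ≠ 0) (i j : n) :
    HasDerivAt (fun s => (M s)⁻¹ i j) (-((M t)⁻¹ * M' * (M t)⁻¹) i j) t := by
  have hadj : ∀ i j, DifferentiableAt ℝ (fun s => (M s).adjugate i j) t := by
    intro i j
    simp only [Matrix.adjugate_apply]
    refine (hasDerivAt_det (M' := M'.updateRow j 0) fun a b => ?_).differentiableAt
    by_cases hab : a = j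
    · subst hab
      simpa using hasDerivAt_const _ _
    · simpa [Matrix.updateRow_ne hab] using h a b
  have hinv : ∀ i j, DifferentiableAt ℝ (fun s => (M s)⁻¹ i j) t := by
    intro i j
    simp only [Matrix.inv_def, Ring.inverse_eq_inv', Matrix.smul_apply, smul_eq_mul]
    exact ((hasDerivAt_det h).differentiableAt.inv hM).mul (hadj i j)
  set N : Matrix n n ℝ := fun i j => deriv (fun s => (M s)⁻¹ i j) t with hN
  have hN' : ∀ i j, HasDerivAt (fun s => (M s)⁻¹ i j) (N i j) t := fun i j =>
    (hinv i j).hasDerivAt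
  have hne : ∀ᶠ s in 𝓝 t, (M s).det ≠ 0 :=
    (hasDerivAt_det h).continuousAt.eventually_ne hM
  have hzero : M' * (M t)⁻¹ + M t * N = 0 := by
    ext a b
    have h1 : HasDerivAt (fun s => ∑ c, M s a c * (M s)⁻¹ c b)
        (∑ c, (M' a c * (M t)⁻¹ c b + M t a c * N c b)) t :=
      HasDerivAt.fun_sum fun c _ => (h a c).mul (hN' c b)
    have h2 : (fun s => ∑ c, M s a c * (M s)⁻¹ c b) =ᶠ[𝓝 t]
        fun _ => (1 : Matrix n n ℝ) a b := by
      filter_upwards [hne] with s hs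
      rw [← Matrix.mul_apply, Matrix.mul_nonsing_inv _ (isUnit_iff_ne_zero.mpr hs)]
    have h3 := h1.unique ((hasDerivAt_const t _).congr_of_eventuallyEq h2)
    rw [Finset.sum_add_distrib] at h3
    simpa [Matrix.add_apply, Matrix.mul_apply] using h3
  have hfin : N = -((M t)⁻¹ * M' * (M t)⁻¹) := by
    have h1 : M t * N = -(M' * (M t)⁻¹) := by
      rw [eq_neg_iff_add_eq_zero, add_comm]; exact hzero
    have h2 := congrArg ((M t)⁻¹ * ·) h1
    simp only [← Matrix.mul_assoc, Matrix.nonsing_inv_mul _ (isUnit_iff_ne_zero.mpr hM),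
      Matrix.one_mul, Matrix.mul_neg] at h2
    exact h2
  have h5 := hN' i j
  rw [hfin] at h5
  exact h5

variable {E : Type*} [NormedAddCommGroup E] [NormedSpace ℝ E]

theorem contDiffOn_det {M : E → Matrix n n ℝ} {S : Set E}
    (h : ∀ i j, ContDiffOn ℝ ∞ (fun q => M q i j) S) :
    ContDiffOn ℝ ∞ (fun q => (M q).det) S := by
  simp only [Matrix.det_apply']
  exact ContDiffOn.sum fun σ _ => contDiffOn_const.mul (contDiffOn_prod fun i _ => h _ _)

theorem contDiffOn_inv_matrix {M : E → Matrix n n ℝ} {S : Set E}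
    (h : ∀ i j, ContDiffOn ℝ ∞ (fun q => M q i j) S) (hM : ∀ q ∈ S, (M q).det ≠ 0) (i j : n) :
    ContDiffOn ℝ ∞ (fun q => (M q)⁻¹ i j) S := by
  simp only [Matrix.inv_def, Ring.inverse_eq_inv', Matrix.smul_apply, smul_eq_mul,
    Matrix.adjugate_apply]
  refine ((contDiffOn_det h).inv hM).mul (contDiffOn_det fun a b => ?_)
  by_cases hab : a = j
  · subst hab
    simpa using contDiffOn_const
  · simpa [Matrix.updateRow_ne hab] using h a b

theorem contDiffOn_sqrt_abs {f : E → ℝ} {S : Set E} (h : ContDiffOn ℝ ∞ f S)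
    (hf : ∀ q ∈ S, f q ≠ 0) : ContDiffOn ℝ ∞ (fun q => Real.sqrt |f q|) S := by
  intro q hq
  exact (((contDiffAt_abs (hf q hq)).comp_contDiffWithinAt q (h q hq)).sqrt
    (abs_ne_zero.mpr (hf q hq)))

end MatrixCalculus

/-! ### Differentiation under the integral sign and vanishing divergence integrals -/

section Integration

/-- Joint smoothness on `O` of a one-parameter family of functions of the coordinates. -/
def SmoothFamily (O : Set (ℝ × Coord)) (f : ℝ → Coord → ℝ) : Prop :=
  ContDiffOn ℝ ∞ (fun q : ℝ × Coord => f q.1 q.2) O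

/-- Differentiation under the integral sign over a compact set. -/
theorem hasDerivAt_setIntegral_of_smoothFamily {O : Set (ℝ × Coord)} (hO : IsOpen O)
    {D : Set Coord} (hD : IsCompact D) (hDO : ∀ x ∈ D, ((0 : ℝ), x) ∈ O)
    {F : ℝ → Coord → ℝ} (hF : SmoothFamily O F)
    {F' : Coord → ℝ} (hF' : ∀ x ∈ D, HasDerivAt (fun s => F s x) (F' x) 0) :
    HasDerivAt (fun s => ∫ x in D, F s x) (∫ x in D, F' x) 0 := by
  rw [SmoothFamily] at hF
  -- a tube `[-r, r] × D` inside `O`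
  obtain ⟨u, v, hu, hv, h0u, hDv, huv⟩ := generalized_tube_lemma
    (isCompact_singleton (x := (0 : ℝ))) hD hO (by
      rintro ⟨s, x⟩ ⟨hs, hx⟩
      rw [mem_singleton_iff] at hs
      simp only at hs
      subst hs
      exact hDO x hx)
  obtain ⟨r, hr, hru⟩ := Metric.nhds_basis_closedBall.mem_iff.mp (hu.mem_nhds (h0u rfl))
  have htube : ∀ s ∈ Metric.closedBall (0 : ℝ) r, ∀ x ∈ D, (s, x) ∈ O := fun s hs x hx =>
    huv ⟨hru hs, hDv hx⟩
  set G : ℝ × Coord → ℝ := fun q =>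
    fderiv ℝ (fun q : ℝ × Coord => F q.1 q.2) q ((1 : ℝ), (0 : Coord)) with hG
  have hGc : ContinuousOn G O :=
    (hF.continuousOn_fderiv_of_isOpen hO (by norm_num)).clm_apply continuousOn_const
  have hder : ∀ s x, (s, x) ∈ O → HasDerivAt (fun s => F s x) (G (s, x)) s := by
    intro s x hsx
    have h1 : HasFDerivAt (fun q : ℝ × Coord => F q.1 q.2) (fderiv ℝ _ (s, x)) (s, x) :=
      ((hF.contDiffAt (hO.mem_nhds hsx)).differentiableAt (by norm_num)).hasFDerivAt
    have h2 : HasDerivAt (fun s : ℝ => (s, x)) ((1 : ℝ), (0 : Coord)) s :=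
      (hasDerivAt_id s).prodMk (hasDerivAt_const s x)
    exact h1.comp_hasDerivAt s h2
  have hslice : ∀ s ∈ Metric.closedBall (0 : ℝ) r, ContinuousOn (fun x => (s, x)) D ∧
      MapsTo (fun x : Coord => (s, x)) D O := fun s hs =>
    ⟨by fun_prop, fun x hx => htube s hs x hx⟩
  obtain ⟨C, hC⟩ := ((isCompact_closedBall (0 : ℝ) r).prod hD).exists_bound_of_continuousOn
    (hGc.mono fun q hq => htube q.1 hq.1 q.2 hq.2)
  have h0 : (0 : ℝ) ∈ Metric.closedBall (0 : ℝ) r := Metric.mem_closedBall_self hr.le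
  have hfin : IsFiniteMeasure (volume.restrict D) := ⟨by simpa using hD.measure_lt_top⟩
  have key := hasDerivAt_integral_of_dominated_loc_of_deriv_le (μ := volume.restrict D)
    (F := F) (F' := fun s x => G (s, x)) (x₀ := (0 : ℝ)) (bound := fun _ => C)
    (Metric.closedBall_mem_nhds (0 : ℝ) hr) ?_ ?_ ?_ ?_ (integrable_const C) ?_
  · have hcongr : ∫ x in D, F' x = ∫ x in D, G (0, x) :=
      setIntegral_congr_fun hD.measurableSet fun x hx =>
        (hF' x hx).unique (hder 0 x (htube 0 h0 x hx))
    rw [hcongr]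
    exact key.2
  · filter_upwards [Metric.closedBall_mem_nhds (0 : ℝ) hr] with s hs
    exact (hF.continuousOn.comp (hslice s hs).1 (hslice s hs).2).aestronglyMeasurable
      hD.measurableSet
  · exact (hF.continuousOn.comp (hslice 0 h0).1 (hslice 0 h0).2).integrableOn_compact hD
  · exact (hGc.comp (hslice 0 h0).1 (hslice 0 h0).2).aestronglyMeasurable hD.measurableSet
  · refine (ae_restrict_mem hD.measurableSet).mono fun x hx s hs => hC (s, x) ⟨hs, hx⟩
  · refine (ae_restrict_mem hD.measurableSet).mono fun x hx s hs => hder s x (htube s hs x hx)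

/-- The integral of a partial derivative of a function supported in a compact set vanishes. -/
theorem setIntegral_pd_eq_zero {U D : Set Coord} (hU : IsOpen U) (hD : IsCompact D) (hDU : D ⊆ U)
    {f : Coord → ℝ} (hf : ContDiffOn ℝ ∞ f U) (hf0 : ∀ x ∈ U, x ∉ D → f x = 0) (k : Fin 4) :
    ∫ x in D, pd k f x = 0 := by
  classical
  -- extension by zero
  set F : Coord → ℝ := D.indicator f with hF
  have hFU : EqOn F f U := by
    intro x hx
    by_cases hxD : x ∈ D
    · simp [hF, hxD]
    · simp [hF, hxD, hf0 x hx hxD]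
  have hFout : ∀ x ∉ D, F =ᶠ[𝓝 x] fun _ => 0 := by
    intro x hx
    filter_upwards [hD.isClosed.isOpen_compl.mem_nhds hx] with y hy
    exact indicator_of_notMem hy f
  have hFin : ∀ x ∈ D, F =ᶠ[𝓝 x] f := fun x hx =>
    hFU.eventuallyEq_of_mem (hU.mem_nhds (hDU hx))
  have hFs : ContDiff ℝ ∞ F := by
    rw [contDiff_iff_contDiffAt]
    intro x
    by_cases hx : x ∈ D
    · exact (hf.contDiffAt (hU.mem_nhds (hDU hx))).congr_of_eventuallyEq (hFin x hx)
    · exact contDiffAt_const.congr_of_eventuallyEq (hFout x hx)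
  have hFsupp : HasCompactSupport F := HasCompactSupport.intro hD fun x hx =>
    indicator_of_notMem hx f
  have h1 : ∫ x in D, pd k f x = ∫ x in D, fderiv ℝ F x (Pi.single k 1) := by
    refine setIntegral_congr_fun hD.measurableSet fun x hx => ?_
    simp only [pd]
    rw [(hFin x hx).fderiv_eq]
  have h2 : ∫ x in D, fderiv ℝ F x (Pi.single k 1) = ∫ x, fderiv ℝ F x (Pi.single k 1) := by
    refine setIntegral_eq_integral_of_forall_compl_eq_zero fun x hx => ?_
    rw [(hFout x hx).fderiv_eq]
    simp
  have hcont : Continuous fun x => fderiv ℝ F x (Pi.single k (1 : ℝ)) :=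
    (hFs.continuous_fderiv (by norm_num)).clm_apply continuous_const
  have hint : Integrable fun x => fderiv ℝ F x (Pi.single k (1 : ℝ)) :=
    hcont.integrable_of_hasCompactSupport
      (hFsupp.fderiv_apply (𝕜 := ℝ) _)
  have h3 := integral_mul_fderiv_eq_neg_fderiv_mul_of_integrable (μ := (volume : Measure Coord))
    (f := fun _ => (1 : ℝ)) (g := F) (v := Pi.single k 1) (by simp) (by simpa using hint)
    (by simpa using hFs.continuous.integrable_of_hasCompactSupport hFsupp)
    (fun _ _ => differentiableAt_const _) (fun x _ => hFs.differentiable (by norm_num) x)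
  rw [h1, h2]
  simpa using h3

end Integration

/-! ### Smooth one-parameter families of functions -/

section Families

/-- The derivative of a one-parameter family at the parameter `0`. -/
def sdot (f : ℝ → Coord → ℝ) (x : Coord) : ℝ := deriv (fun s => f s x) 0

variable {O : Set (ℝ × Coord)} {f g : ℝ → Coord → ℝ}

theorem SmoothFamily.add (hf : SmoothFamily O f) (hg : SmoothFamily O g) :
    SmoothFamily O (fun s x => f s x + g s x) := ContDiffOn.add hf hg

theorem SmoothFamily.sub (hf : SmoothFamily O f) (hg : SmoothFamily O g) :
    SmoothFamily O (fun s x => f s x - g s x) := ContDiffOn.sub hf hg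

theorem SmoothFamily.mul (hf : SmoothFamily O f) (hg : SmoothFamily O g) :
    SmoothFamily O (fun s x => f s x * g s x) := ContDiffOn.mul hf hg

theorem SmoothFamily.const (f : ℝ) : SmoothFamily O (fun _ _ => f) := contDiffOn_const

theorem SmoothFamily.sum {ι : Type*} {t : Finset ι} {f : ι → ℝ → Coord → ℝ}
    (hf : ∀ i, SmoothFamily O (f i)) : SmoothFamily O (fun s x => ∑ i ∈ t, f i s x) :=
  ContDiffOn.sum fun i _ => hf i

theorem SmoothFamily.congr (hf : SmoothFamily O f) (h : ∀ s x, (s, x) ∈ O → g s x = f s x) :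
    SmoothFamily O g := ContDiffOn.congr hf fun q hq => h q.1 q.2 hq

theorem SmoothFamily.mono {O' : Set (ℝ × Coord)} (hf : SmoothFamily O f) (h : O' ⊆ O) :
    SmoothFamily O' f := ContDiffOn.mono hf h

theorem isOpen_slice (hO : IsOpen O) (s : ℝ) : IsOpen {x : Coord | (s, x) ∈ O} :=
  hO.preimage (by fun_prop : Continuous fun x : Coord => (s, x))

theorem SmoothFamily.slice (hf : SmoothFamily O f) (s : ℝ) :
    ContDiffOn ℝ ∞ (f s) {x | (s, x) ∈ O} :=
  ContDiffOn.comp (g := fun q : ℝ × Coord => f q.1 q.2) (f := fun x : Coord => (s, x)) hf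
    (by fun_prop) fun _ hx => hx

theorem SmoothFamily.hasFDerivAt (hO : IsOpen O) (hf : SmoothFamily O f) {q : ℝ × Coord}
    (hq : q ∈ O) : HasFDerivAt (fun q : ℝ × Coord => f q.1 q.2)
      (fderiv ℝ (fun q : ℝ × Coord => f q.1 q.2) q) q :=
  ((ContDiffOn.contDiffAt hf (hO.mem_nhds hq)).differentiableAt (by norm_num)).hasFDerivAt

theorem SmoothFamily.fderiv_apply (hO : IsOpen O) (hf : SmoothFamily O f) (v : ℝ × Coord) :
    SmoothFamily O
      (fun s x => fderiv ℝ (fun q : ℝ × Coord => f q.1 q.2) (s, x) v) :=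
  (ContDiffOn.fderiv_of_isOpen hf hO (by norm_num)).clm_apply contDiffOn_const

theorem SmoothFamily.pd_eq (hO : IsOpen O) (hf : SmoothFamily O f) (k : Fin 4) {s : ℝ} {x : Coord}
    (hq : (s, x) ∈ O) : pd k (f s) x =
      fderiv ℝ (fun q : ℝ × Coord => f q.1 q.2) (s, x) ((0 : ℝ), Pi.single k 1) := by
  have h1 : HasFDerivAt (fun y : Coord => (s, y)) (ContinuousLinearMap.inr ℝ ℝ Coord) x :=
    hasFDerivAt_prodMk_right s x
  have h2 := (hf.hasFDerivAt hO hq).comp x h1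
  have h3 : fderiv ℝ (f s) x = _ := HasFDerivAt.fderiv h2
  rw [pd, h3]
  rfl

theorem SmoothFamily.hasDerivAt_fderiv (hO : IsOpen O) (hf : SmoothFamily O f) {s : ℝ} {x : Coord}
    (hq : (s, x) ∈ O) : HasDerivAt (fun s => f s x)
      (fderiv ℝ (fun q : ℝ × Coord => f q.1 q.2) (s, x) ((1 : ℝ), (0 : Coord))) s := by
  have h2 : HasDerivAt (fun s : ℝ => (s, x)) ((1 : ℝ), (0 : Coord)) s :=
    (hasDerivAt_id s).prodMk (hasDerivAt_const s x)
  exact (hf.hasFDerivAt hO hq).comp_hasDerivAt s h2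

theorem SmoothFamily.pd (hO : IsOpen O) (hf : SmoothFamily O f) (k : Fin 4) :
    SmoothFamily O (fun s x => pd k (f s) x) :=
  (hf.fderiv_apply hO ((0 : ℝ), Pi.single k 1)).congr fun _ _ hq => hf.pd_eq hO k hq

theorem SmoothFamily.hasDerivAt (hO : IsOpen O) (hf : SmoothFamily O f) {x : Coord}
    (hq : ((0 : ℝ), x) ∈ O) : HasDerivAt (fun s => f s x) (sdot f x) 0 :=
  (hf.hasDerivAt_fderiv hO hq).differentiableAt.hasDerivAt

theorem SmoothFamily.sdot_eq (hO : IsOpen O) (hf : SmoothFamily O f) {x : Coord}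
    (hq : ((0 : ℝ), x) ∈ O) : sdot f x =
      fderiv ℝ (fun q : ℝ × Coord => f q.1 q.2) (0, x) ((1 : ℝ), (0 : Coord)) :=
  (hf.hasDerivAt_fderiv hO hq).deriv

theorem SmoothFamily.contDiffOn_sdot (hO : IsOpen O) (hf : SmoothFamily O f) :
    ContDiffOn ℝ ∞ (sdot f) {x | ((0 : ℝ), x) ∈ O} :=
  ((hf.fderiv_apply hO ((1 : ℝ), (0 : Coord))).slice 0).congr fun _ hx => hf.sdot_eq hO hx

/-- The parameter derivative commutes with partial derivatives, by the symmetry of second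
derivatives. -/
theorem SmoothFamily.hasDerivAt_pd (hO : IsOpen O) (hf : SmoothFamily O f) (k : Fin 4) {x : Coord}
    (hq : ((0 : ℝ), x) ∈ O) :
    HasDerivAt (fun s => GenRiem.pd k (f s) x) (GenRiem.pd k (sdot f) x) 0 := by
  set F : ℝ × Coord → ℝ := fun q => f q.1 q.2 with hF
  have h1 := (hf.pd hO k).hasDerivAt hO hq
  convert h1 using 1
  have hFq : ContDiffAt ℝ ∞ F (0, x) := ContDiffOn.contDiffAt hf (hO.mem_nhds hq)
  have hsymm := hFq.isSymmSndFDerivAt (by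
    rw [minSmoothness_of_isRCLikeNormedField]; exact WithTop.coe_le_coe.mpr le_top)
  have hdF : DifferentiableAt ℝ (fderiv ℝ F) (0, x) :=
    (hFq.fderiv_right (m := 1) (by norm_cast)).differentiableAt (by norm_num)
  have happ : ∀ v w : ℝ × Coord, fderiv ℝ (fun q => fderiv ℝ F q v) (0, x) w =
      fderiv ℝ (fderiv ℝ F) (0, x) w v := by
    intro v w
    rw [fderiv_clm_apply hdF (differentiableAt_const v)]
    simp
  have e1 : GenRiem.pd k (sdot f) x =
      fderiv ℝ (fderiv ℝ F) (0, x) ((0 : ℝ), Pi.single k 1) ((1 : ℝ), (0 : Coord)) := by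
    rw [← happ, ← (hf.fderiv_apply hO ((1 : ℝ), (0 : Coord))).pd_eq hO k hq, GenRiem.pd,
      GenRiem.pd]
    congr 1
    refine Filter.EventuallyEq.fderiv_eq ?_
    filter_upwards [(isOpen_slice hO 0).mem_nhds hq] with y hy
    exact hf.sdot_eq hO hy
  have e2 : sdot (fun s x => GenRiem.pd k (f s) x) x =
      fderiv ℝ (fderiv ℝ F) (0, x) ((1 : ℝ), (0 : Coord)) ((0 : ℝ), Pi.single k 1) := by
    rw [← happ, (hf.pd hO k).sdot_eq hO hq]
    congr 1
    refine Filter.EventuallyEq.fderiv_eq ?_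
    filter_upwards [hO.mem_nhds hq] with y hy
    exact hf.pd_eq hO k hy
  rw [e1, e2]
  exact hsymm _ _

end Families

/-! ### Rules for partial derivatives -/

section PartialDerivatives

variable {f h : Coord → ℝ} {x : Coord} {k : Fin 4}

theorem pd_congr (hfh : f =ᶠ[𝓝 x] h) : pd k f x = pd k h x := by
  rw [pd, pd, hfh.fderiv_eq]

theorem pd_const (a : ℝ) : pd k (fun _ => a) x = 0 := by simp [pd]

theorem pd_neg : pd k (fun y => -f y) x = -pd k f x := by
  simp [pd, fderiv_fun_neg]

theorem pd_add (hf : DifferentiableAt ℝ f x) (hh : DifferentiableAt ℝ h x) :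
    pd k (fun y => f y + h y) x = pd k f x + pd k h x := by
  simp [pd, fderiv_fun_add hf hh]

theorem pd_sub (hf : DifferentiableAt ℝ f x) (hh : DifferentiableAt ℝ h x) :
    pd k (fun y => f y - h y) x = pd k f x - pd k h x := by
  simp [pd, fderiv_fun_sub hf hh]

theorem pd_mul (hf : DifferentiableAt ℝ f x) (hh : DifferentiableAt ℝ h x) :
    pd k (fun y => f y * h y) x = pd k f x * h x + f x * pd k h x := by
  simp [pd, fderiv_fun_mul hf hh]
  ring

theorem pd_const_mul (a : ℝ) (hf : DifferentiableAt ℝ f x) :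
    pd k (fun y => a * f y) x = a * pd k f x := by
  simp [pd, fderiv_const_mul hf]

theorem pd_sum {ι : Type*} {t : Finset ι} {f : ι → Coord → ℝ}
    (hf : ∀ i, DifferentiableAt ℝ (f i) x) :
    pd k (fun y => ∑ i ∈ t, f i y) x = ∑ i ∈ t, pd k (f i) x := by
  simp [pd, fderiv_fun_sum fun i _ => hf i]

theorem hasDerivAt_line (hf : DifferentiableAt ℝ f x) :
    HasDerivAt (fun t : ℝ => f (x + t • Pi.single k 1)) (pd k f x) 0 :=
  hf.hasFDerivAt.hasLineDerivAt (Pi.single k 1)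

theorem contDiffOn_pd {V : Set Coord} (hV : IsOpen V) (hf : ContDiffOn ℝ ∞ f V) :
    ContDiffOn ℝ ∞ (pd k f) V :=
  (hf.fderiv_of_isOpen hV (by norm_num)).clm_apply contDiffOn_const

theorem differentiableAt_of_contDiffOn {V : Set Coord} (hV : IsOpen V) (hf : ContDiffOn ℝ ∞ f V)
    (hx : x ∈ V) : DifferentiableAt ℝ f x :=
  (hf.contDiffAt (hV.mem_nhds hx)).differentiableAt (by norm_num)

end PartialDerivatives

/-! ### Total skewness of the torsion -/

section Algebra

variable (g : Field2) (x : Coord)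

theorem symPart_apply (i j : Fin 4) : symPart g x i j = (1 / 2) * (g x i j + g x j i) := by
  simp [symPart, Matrix.transpose_apply]

theorem symPart_symm (i j : Fin 4) : symPart g x i j = symPart g x j i := by
  rw [symPart_apply, symPart_apply, add_comm]

theorem symPart_transpose : (symPart g x).transpose = symPart g x := by
  ext i j; exact symPart_symm g x j i

theorem gInv_transpose : (gInv g x).transpose = gInv g x := by
  rw [gInv, Matrix.transpose_nonsing_inv, symPart_transpose]

theorem gInv_symm (i j : Fin 4) : gInv g x i j = gInv g x j i :=
  congrFun (congrFun (gInv_transpose g x) j) i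

variable {g x}

theorem gInv_mul_symPart (hx : (symPart g x).det ≠ 0) : gInv g x * symPart g x = 1 :=
  Matrix.nonsing_inv_mul _ (isUnit_iff_ne_zero.mpr hx)

theorem symPart_mul_gInv (hx : (symPart g x).det ≠ 0) : symPart g x * gInv g x = 1 :=
  Matrix.mul_nonsing_inv _ (isUnit_iff_ne_zero.mpr hx)

/-- A symmetric array contracted with a skew one vanishes. -/
theorem sum_symm_mul_skew {S L : Fin 4 → Fin 4 → ℝ} (hS : ∀ i j, S i j = S j i)
    (hL : ∀ i j, L i j = -L j i) : ∑ i, ∑ j, S i j * L i j = 0 := by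
  have h1 : ∑ i, ∑ j, S i j * L i j = -∑ i, ∑ j, S i j * L i j := by
    conv_lhs => rw [Finset.sum_comm]
    rw [← Finset.sum_neg_distrib]
    refine Finset.sum_congr rfl fun i _ => ?_
    rw [← Finset.sum_neg_distrib]
    refine Finset.sum_congr rfl fun j _ => ?_
    rw [hS j i, hL j i]
    ring
  linarith

variable (g x)

/-- The cyclic sum of the partial derivatives of the anti-symmetric part of the metric, which is
the covariant torsion. -/
def skewCurl (i j k : Fin 4) : ℝ :=
  (1 / 2) * (pd k (fun y => g y j i) x - pd i (fun y => g y j k) x + pd j (fun y => g y i k) x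
    - pd j (fun y => g y k i) x + pd i (fun y => g y k j) x - pd k (fun y => g y i j) x)

theorem skewCurl_swap_left (i j k : Fin 4) : skewCurl g x i j k = -skewCurl g x j i k := by
  simp only [skewCurl]; ring

theorem skewCurl_swap_right (i j k : Fin 4) : skewCurl g x i j k = -skewCurl g x i k j := by
  simp only [skewCurl]; ring

theorem torsion_eq_sum_skewCurl (i j k : Fin 4) :
    torsion g i j k x = ∑ a, gInv g x i a * skewCurl g x a j k := by
  simp only [torsion, christoffelSkew, christoffel, skewCurl]
  rw [← mul_sub, ← Finset.sum_sub_distrib, Finset.mul_sum, Finset.mul_sum, Finset.mul_sum]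
  refine Finset.sum_congr rfl fun a _ => ?_
  ring

theorem torsion_swap (i j k : Fin 4) : torsion g i j k x = -torsion g i k j x := by
  simp only [torsion, christoffelSkew]; ring

/-- The torsion is trace-free: its trace contracts the symmetric `g^{ab}` with the skew curl. -/
theorem sum_torsion_right (j : Fin 4) : ∑ a, torsion g a j a x = 0 := by
  simp only [torsion_eq_sum_skewCurl]
  exact sum_symm_mul_skew (S := fun a b => gInv g x a b) (L := fun a b => skewCurl g x b j a)
    (gInv_symm g x) fun a b => by
      rw [skewCurl_swap_left, skewCurl_swap_right, skewCurl_swap_left g x a j b, neg_neg]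

variable {g x}

/-- Lowering the index of the torsion undoes the inverse metric in the Christoffel symbols, which
makes the total skewness of the torsion visible. -/
theorem torsionLow_eq_skewCurl (hx : (symPart g x).det ≠ 0) (i j k : Fin 4) :
    torsionLow g x i j k = skewCurl g x i j k := by
  have h : ∀ b, ∑ a, symPart g x i a * gInv g x a b = if i = b then 1 else 0 := fun b => by
    rw [← Matrix.mul_apply, symPart_mul_gInv hx, Matrix.one_apply]
  simp only [torsionLow, torsion_eq_sum_skewCurl, Finset.mul_sum, ← mul_assoc]
  rw [Finset.sum_comm]
  simp only [← Finset.sum_mul, h]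
  simp

theorem torsion_eq_sum_torsionLow (hx : (symPart g x).det ≠ 0) (i j k : Fin 4) :
    torsion g i j k x = ∑ a, gInv g x i a * torsionLow g x a j k := by
  simp only [torsionLow_eq_skewCurl hx, torsion_eq_sum_skewCurl]

theorem torsionSq_eq (hx : (symPart g x).det ≠ 0) :
    torsionSq g x = ∑ c, ∑ d, gInv g x c d *
      ∑ a, ∑ b, torsion g a c b x * torsion g b d a x := by
  have h : ∀ a b c d, torsion g a c b x * torsion g b d a x =
      ∑ e, ∑ z, gInv g x a e * torsionLow g x e c b * (gInv g x b z * torsionLow g x z d a) :=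
    fun a b c d => by
      rw [torsion_eq_sum_torsionLow hx, torsion_eq_sum_torsionLow hx, Finset.sum_mul_sum]
  simp only [torsionSq, torsionPair, h, Finset.mul_sum]
  refine Finset.sum_congr rfl fun c _ => Finset.sum_congr rfl fun d _ =>
    Finset.sum_congr rfl fun a _ => ?_
  rw [Finset.sum_comm]
  refine Finset.sum_congr rfl fun b _ => Finset.sum_congr rfl fun e _ =>
    Finset.sum_congr rfl fun z _ => ?_
  ring

end Algebra

/-! ### The Levi-Civita connection of the symmetric part -/

section Connection

variable {g : Field2} {x : Coord}

theorem christoffelSym_symm (g : Field2) (i j k : Fin 4) (x : Coord) :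
    christoffelSym g i j k x = christoffelSym g i k j x := by
  simp only [christoffelSym]; ring

theorem pd_symPart (hg : ∀ i j, DifferentiableAt ℝ (fun y => g y i j) x) (k i j : Fin 4) :
    pd k (fun y => symPart g y i j) x =
      (1 / 2) * (pd k (fun y => g y i j) x + pd k (fun y => g y j i) x) := by
  simp only [symPart_apply]
  rw [pd_const_mul (f := fun y => g y i j + g y j i) _ ((hg i j).add (hg j i)),
    pd_add (hg i j) (hg j i)]

/-- The symmetric part of the connection is the Levi-Civita connection of the symmetric part of
the metric. -/
theorem christoffelSym_eq (hg : ∀ i j, DifferentiableAt ℝ (fun y => g y i j) x) (i j k : Fin 4) :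
    christoffelSym g i j k x = ∑ a, gInv g x i a * ((1 / 2) *
      (pd k (fun y => symPart g y a j) x - pd a (fun y => symPart g y j k) x
        + pd j (fun y => symPart g y a k) x)) := by
  simp only [pd_symPart hg, christoffelSym, christoffel]
  rw [← mul_add, ← Finset.sum_add_distrib, Finset.mul_sum, Finset.mul_sum]
  refine Finset.sum_congr rfl fun a _ => ?_
  ring

theorem sum_symPart_mul_christoffelSym (hx : (symPart g x).det ≠ 0)
    (hg : ∀ i j, DifferentiableAt ℝ (fun y => g y i j) x) (i j k : Fin 4) :
    ∑ a, symPart g x i a * christoffelSym g a j k x = (1 / 2) *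
      (pd k (fun y => symPart g y i j) x - pd i (fun y => symPart g y j k) x
        + pd j (fun y => symPart g y i k) x) := by
  have h : ∀ b, ∑ a, symPart g x i a * gInv g x a b = if i = b then 1 else 0 := fun b => by
    rw [← Matrix.mul_apply, symPart_mul_gInv hx, Matrix.one_apply]
  simp only [christoffelSym_eq hg, Finset.mul_sum, ← mul_assoc]
  rw [Finset.sum_comm]
  simp only [← Finset.sum_mul, h]
  simp

/-- The matrix `Γ^i_{bk}` (row `i`, column `b`) of the Levi-Civita connection in the direction
`k`. -/
def connMatrix (g : Field2) (k : Fin 4) (x : Coord) : Matrix (Fin 4) (Fin 4) ℝ :=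
  Matrix.of fun i b => christoffelSym g i b k x

/-- Metric compatibility of the Levi-Civita connection. -/
theorem pd_symPart_eq (hx : (symPart g x).det ≠ 0)
    (hg : ∀ i j, DifferentiableAt ℝ (fun y => g y i j) x) (k : Fin 4) :
    (Matrix.of fun i j => pd k (fun y => symPart g y i j) x) =
      symPart g x * connMatrix g k x + (connMatrix g k x).transpose * symPart g x := by
  have hs : ∀ k i j, pd k (fun y => symPart g y i j) x = pd k (fun y => symPart g y j i) x :=
    fun k i j => by simp only [symPart_symm g _ i j]
  ext i j
  have h1 : ((connMatrix g k x).transpose * symPart g x) i j =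
      ∑ a, symPart g x j a * christoffelSym g a i k x := by
    rw [Matrix.mul_apply]
    refine Finset.sum_congr rfl fun a _ => ?_
    simp only [Matrix.transpose_apply, connMatrix, Matrix.of_apply]
    rw [symPart_symm g x a j, mul_comm]
  have h2 : (symPart g x * connMatrix g k x) i j =
      ∑ a, symPart g x i a * christoffelSym g a j k x := by
    rw [Matrix.mul_apply]; rfl
  rw [Matrix.add_apply, h1, h2, sum_symPart_mul_christoffelSym hx hg,
    sum_symPart_mul_christoffelSym hx hg, Matrix.of_apply, hs k j i]
  rw [hs j i k, hs i j k, hs j k i, hs i k j]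
  ring

theorem differentiableAt_symPart (hg : ∀ i j, DifferentiableAt ℝ (fun y => g y i j) x)
    (i j : Fin 4) : DifferentiableAt ℝ (fun y => symPart g y i j) x := by
  simp only [symPart_apply]
  exact ((hg i j).add (hg j i)).const_mul _

/-- Jacobi's formula along a coordinate line, combined with metric compatibility:
`∂_k √|g| = √|g| Γ^a_{ak}`. -/
theorem pd_volDensity (hx : (symPart g x).det ≠ 0)
    (hg : ∀ i j, DifferentiableAt ℝ (fun y => g y i j) x)
    (hvol : DifferentiableAt ℝ (volDensity g) x) (k : Fin 4) :
    pd k (volDensity g) x = volDensity g x * ∑ a, christoffelSym g a a k x := by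
  have h0 : x + (0 : ℝ) • (Pi.single k 1 : Coord) = x := by simp
  have h1 := hasDerivAt_sqrt_abs_det (M := fun t : ℝ => symPart g (x + t • Pi.single k 1))
    (M' := Matrix.of fun i j => pd k (fun y => symPart g y i j) x) (t := 0)
    (fun i j => hasDerivAt_line (differentiableAt_symPart hg i j)) (by simpa only [h0] using hx)
  have h2 := (hasDerivAt_line (k := k) hvol).unique h1
  rw [h2, pd_symPart_eq hx hg]
  simp only [h0]
  change volDensity g x * (1 / 2 * (gInv g x * _).trace) = _
  congr 1
  have h3 : (gInv g x * ((connMatrix g k x).transpose * symPart g x)).trace =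
      (connMatrix g k x).trace := by
    rw [Matrix.trace_mul_comm, Matrix.mul_assoc, symPart_mul_gInv hx, Matrix.mul_one,
      Matrix.trace_transpose]
  rw [Matrix.mul_add, Matrix.trace_add, h3, ← Matrix.mul_assoc, gInv_mul_symPart hx,
    Matrix.one_mul]
  have h4 : (connMatrix g k x).trace = ∑ a, christoffelSym g a a k x := rfl
  rw [h4]; ring

/-- Metric compatibility in contravariant form. -/
theorem pd_gInv (hx : (symPart g x).det ≠ 0)
    (hg : ∀ i j, DifferentiableAt ℝ (fun y => g y i j) x)
    (hP : ∀ i j, DifferentiableAt ℝ (fun y => gInv g y i j) x) (k i j : Fin 4) :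
    pd k (fun y => gInv g y i j) x =
      -(∑ b, christoffelSym g i b k x * gInv g x b j)
        - ∑ b, gInv g x i b * christoffelSym g j b k x := by
  have h0 : x + (0 : ℝ) • (Pi.single k 1 : Coord) = x := by simp
  have h1 := hasDerivAt_inv_matrix (M := fun t : ℝ => symPart g (x + t • Pi.single k 1))
    (M' := Matrix.of fun i j => pd k (fun y => symPart g y i j) x) (t := 0)
    (fun i j => hasDerivAt_line (differentiableAt_symPart hg i j)) (by simpa only [h0] using hx)
    i j
  have h2 := (hasDerivAt_line (k := k) (hP i j)).unique h1
  rw [h2, pd_symPart_eq hx hg]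
  simp only [h0]
  change -(gInv g x * (_ : Matrix (Fin 4) (Fin 4) ℝ) * gInv g x) i j = _
  have h3 : gInv g x * (symPart g x * connMatrix g k x
      + (connMatrix g k x).transpose * symPart g x) * gInv g x =
      connMatrix g k x * gInv g x + gInv g x * (connMatrix g k x).transpose := by
    rw [Matrix.mul_add, Matrix.add_mul, ← Matrix.mul_assoc, gInv_mul_symPart hx, Matrix.one_mul,
      Matrix.mul_assoc (gInv g x), Matrix.mul_assoc _ (symPart g x), symPart_mul_gInv hx,
      Matrix.mul_one]
  rw [h3, Matrix.add_apply, Matrix.mul_apply, Matrix.mul_apply, neg_add, ← sub_eq_add_neg]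
  rfl

end Connection

/-! ### The family of scalar curvatures -/

section ScalarCurvature

variable {g : Field2} {x : Coord}

theorem torsionCov_swap (i j k n : Fin 4) : torsionCov g i j k n x = -torsionCov g i k j n x := by
  have h1 : pd n (torsion g i j k) x = -pd n (torsion g i k j) x := by
    rw [← pd_neg]
    congr 1
    funext y
    exact torsion_swap g y i j k
  simp only [torsionCov, h1]
  have h2 : ∀ a, torsion g a j k x = -torsion g a k j x := fun a => torsion_swap g x a j k
  have h3 : ∀ a, torsion g i a k x = -torsion g i k a x := fun a => torsion_swap g x i a k
  have h4 : ∀ a, torsion g i j a x = -torsion g i a j x := fun a => torsion_swap g x i j a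
  simp only [h2, h3, h4, mul_neg, Finset.sum_neg_distrib]
  ring

/-- Covariant differentiation commutes with the trace of the torsion, which is zero. -/
theorem sum_torsionCov (hT : ∀ i j k, DifferentiableAt ℝ (torsion g i j k) x) (i n : Fin 4) :
    ∑ a, torsionCov g a i a n x = 0 := by
  have h1 : ∑ a, pd n (torsion g a i a) x = 0 := by
    rw [← pd_sum fun a => hT a i a]
    simp only [sum_torsion_right]
    exact pd_const 0
  have h2 : ∑ a, ∑ b, christoffelSym g b i n x * torsion g a b a x = 0 := by
    rw [Finset.sum_comm]
    simp only [← Finset.mul_sum, sum_torsion_right, mul_zero, Finset.sum_const_zero]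
  have h3 : ∑ a, ∑ b, christoffelSym g a b n x * torsion g b i a x =
      ∑ a, ∑ b, christoffelSym g b a n x * torsion g a i b x := Finset.sum_comm
  simp only [torsionCov, Finset.sum_sub_distrib, Finset.sum_add_distrib, h1, h2, h3]
  ring

/-- The scalar curvatures of the family: the terms in the coefficients `u`, `u'` and `v` drop out
because the torsion is totally skew. -/
theorem scalarFamily_eq (hx : (symPart g x).det ≠ 0)
    (hT : ∀ i j k, DifferentiableAt ℝ (torsion g i j k) x) (c : Coeffs) :
    scalarFamily c g x = scalarCurv g x - (c.v' + c.w) * torsionSq g x := by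
  have hu : ∑ i, ∑ j, gInv g x i j * ∑ a, torsionCov g a i j a x = 0 :=
    sum_symm_mul_skew (gInv_symm g x) fun i j => by
      rw [← Finset.sum_neg_distrib]
      exact Finset.sum_congr rfl fun a _ => torsionCov_swap a i j a
  have hv : ∀ i j, ∑ a, ∑ b, torsion g b i j x * torsion g a b a x = 0 := fun i j => by
    rw [Finset.sum_comm]
    simp only [← Finset.mul_sum, sum_torsion_right, mul_zero, Finset.sum_const_zero]
  have hv' : ∑ i, ∑ j, gInv g x i j * ∑ a, ∑ b, torsion g b i a x * torsion g a b j x =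
      -torsionSq g x := by
    rw [torsionSq_eq hx]
    simp only [← Finset.sum_neg_distrib, ← mul_neg]
    refine Finset.sum_congr rfl fun i _ => Finset.sum_congr rfl fun j _ => ?_
    rw [Finset.sum_comm]
    simp only [← torsion_swap]
  have hw : ∑ i, ∑ j, gInv g x i j * ∑ a, ∑ b, torsion g b j a x * torsion g a b i x =
      -torsionSq g x := by
    rw [← hv', Finset.sum_comm]
    simp only [gInv_symm g x]
  have hK : ∀ i j, ricciFamily c g i j x = ricci g i j x
      + c.u * ∑ a, torsionCov g a i j a x
      + c.v' * ∑ a, ∑ b, torsion g b i a x * torsion g a b j x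
      + c.w * ∑ a, ∑ b, torsion g b j a x * torsion g a b i x := fun i j => by
    simp only [ricciFamily, curvFamily, Finset.sum_add_distrib, ← Finset.mul_sum,
      sum_torsionCov hT, hv, ricci]
    ring
  have hterm : ∀ (k : ℝ) (M : Fin 4 → Fin 4 → ℝ),
      ∑ i, ∑ j, gInv g x i j * (k * M i j) = k * ∑ i, ∑ j, gInv g x i j * M i j := by
    intro k M
    simp only [Finset.mul_sum]
    refine Finset.sum_congr rfl fun i _ => Finset.sum_congr rfl fun j _ => ?_
    ring
  simp only [scalarFamily, hK, mul_add, Finset.sum_add_distrib, hterm, hu, hv', hw]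
  rw [scalarCurv]
  ring

end ScalarCurvature

/-! ### Finite sums behind the Palatini identity -/

section NestedSums

variable {ι : Type*} [Fintype ι]

theorem sum_four_nested (f : ι → ι → ι → ι → ℝ) :
    ∑ i, ∑ j, ∑ k, ∑ l, f i j k l =
      ∑ p : ι × ι × ι × ι, f p.1 p.2.1 p.2.2.1 p.2.2.2 := by
  simp only [Fintype.sum_prod_type]

theorem sum_six_nested (f : ι → ι → ι → ι → ι → ι → ℝ) :
    ∑ i, ∑ j, ∑ k, ∑ l, ∑ m, ∑ n, f i j k l m n =
      ∑ p : ι × ι × ι × ι × ι × ι,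
        f p.1 p.2.1 p.2.2.1 p.2.2.2.1 p.2.2.2.2.1 p.2.2.2.2.2 := by
  simp only [Fintype.sum_prod_type]

end NestedSums

section PalatiniAlgebra

variable {P : Fin 4 → Fin 4 → ℝ} {Γ C : Fin 4 → Fin 4 → Fin 4 → ℝ}
  {dC : Fin 4 → Fin 4 → Fin 4 → Fin 4 → ℝ}

/-- The algebraic core of the Palatini identity: here `C` stands for the variation of the
connection `Γ`, `dC k` for its partial derivatives, and the partial derivatives of `P` are
expressed through `Γ` by metric compatibility. -/
theorem palatini_algebra (hP : ∀ i j, P i j = P j i) (hΓ : ∀ i j k, Γ i j k = Γ i k j)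
    (hC : ∀ i j k, C i j k = C i k j) :
    ∑ k, ((∑ i, ∑ j, ((-(∑ b, Γ i b k * P b j) - ∑ b, P i b * Γ j b k) * C k i j
          + P i j * dC k k i j)
        - ∑ i, ((-(∑ b, Γ i b k * P b k) - ∑ b, P i b * Γ k b k) * ∑ a, C a i a
          + P i k * ∑ a, dC k a i a))
        + (∑ a, Γ a a k) * (∑ i, ∑ j, P i j * C k i j - ∑ i, P i k * ∑ a, C a i a)) =
      ∑ i, ∑ j, P i j * ((∑ a, dC a a i j) - (∑ a, dC j a i a)
        + (∑ a, ∑ b, (C b i j * Γ a b a + Γ b i j * C a b a))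
        - ∑ a, ∑ b, (C b i a * Γ a b j + Γ b i a * C a b j)) := by
  -- After expansion, every term on the left is a relabelling of one on the right; the terms in `h4`
  -- cancel against each other.
  have hdC : ∑ k, ∑ i, ∑ j, P i j * dC k k i j = ∑ i, ∑ j, P i j * ∑ a, dC a a i j := by
    simp only [Finset.mul_sum]
    rw [Finset.sum_comm]
    exact Finset.sum_congr rfl fun i _ => Finset.sum_comm
  have hdC' : ∑ k, ∑ i, P i k * ∑ a, dC k a i a = ∑ i, ∑ j, P i j * ∑ a, dC j a i a :=
    Finset.sum_comm
  have h1 : ∑ k, ∑ i, ∑ j, (∑ b, Γ i b k * P b j) * C k i j =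
      ∑ i, ∑ j, P i j * ∑ a, ∑ b, C b i a * Γ a b j := by
    simp only [Finset.mul_sum, Finset.sum_mul]
    rw [sum_four_nested, sum_four_nested]
    refine Fintype.sum_equiv ⟨fun p => (p.2.2.1, p.2.2.2, p.2.1, p.1),
      fun p => (p.2.2.2, p.2.2.1, p.1, p.2.1), fun _ => rfl, fun _ => rfl⟩ _ _ fun p => ?_
    simp only [Equiv.coe_fn_mk]
    rw [hP p.2.2.2, hΓ p.2.1, hC p.1 p.2.1]
    ring
  have h2 : ∑ k, ∑ i, ∑ j, (∑ b, P i b * Γ j b k) * C k i j =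
      ∑ i, ∑ j, P i j * ∑ a, ∑ b, Γ b i a * C a b j := by
    simp only [Finset.mul_sum, Finset.sum_mul]
    rw [sum_four_nested, sum_four_nested]
    refine Fintype.sum_equiv ⟨fun p => (p.2.2.2, p.2.1, p.1, p.2.2.1),
      fun p => (p.2.2.1, p.2.1, p.2.2.2, p.1), fun _ => rfl, fun _ => rfl⟩ _ _ fun p => ?_
    simp only [Equiv.coe_fn_mk]
    rw [hP p.2.1, hC p.1 p.2.1]
    ring
  have h3 : ∑ k, ∑ i, (∑ b, Γ i b k * P b k) * ∑ a, C a i a =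
      ∑ i, ∑ j, P i j * ∑ a, ∑ b, Γ b i j * C a b a := by
    simp only [Finset.sum_mul_sum]
    simp only [Finset.mul_sum]
    rw [sum_four_nested, sum_four_nested]
    refine Fintype.sum_equiv ⟨fun p => (p.2.2.1, p.1, p.2.2.2, p.2.1),
      fun p => (p.2.1, p.2.2.2, p.1, p.2.2.1), fun _ => rfl, fun _ => rfl⟩ _ _ fun p => ?_
    simp only [Equiv.coe_fn_mk]
    ring
  have h4 : ∑ k, ∑ i, (∑ b, P i b * Γ k b k) * ∑ a, C a i a =
      ∑ k, (∑ a, Γ a a k) * ∑ i, P i k * ∑ a, C a i a := by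
    simp only [Finset.sum_mul_sum]
    simp only [Finset.mul_sum]
    rw [sum_four_nested, sum_four_nested]
    refine Fintype.sum_equiv ⟨fun p => (p.2.2.1, p.1, p.2.1, p.2.2.2),
      fun p => (p.2.1, p.2.2.1, p.1, p.2.2.2), fun _ => rfl, fun _ => rfl⟩ _ _ fun p => ?_
    simp only [Equiv.coe_fn_mk]
    rw [hΓ p.1]
    ring
  have h5 : ∑ k, (∑ a, Γ a a k) * ∑ i, ∑ j, P i j * C k i j =
      ∑ i, ∑ j, P i j * ∑ a, ∑ b, C b i j * Γ a b a := by
    simp only [Finset.sum_mul_sum]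
    simp only [Finset.mul_sum]
    rw [sum_four_nested, sum_four_nested]
    refine Fintype.sum_equiv ⟨fun p => (p.2.2.1, p.2.2.2, p.2.1, p.1),
      fun p => (p.2.2.2, p.2.2.1, p.1, p.2.1), fun _ => rfl, fun _ => rfl⟩ _ _ fun p => ?_
    simp only [Equiv.coe_fn_mk]
    rw [hΓ p.2.1 p.1]
    ring
  simp only [mul_add, mul_sub, sub_mul, neg_mul, Finset.sum_add_distrib,
    Finset.sum_sub_distrib, Finset.sum_neg_distrib, hdC, hdC', h1, h2, h3, h4, h5]
  ring

end PalatiniAlgebra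

/-! ### The torsion pairing and its derivative -/

section TorsionPairing

/-- The pairing `A^{cd} B^{ae} C^{bz} T_{ecb} S_{zda}` with three independent contravariant
arrays. -/
def torsionPairMulti (A B C : Matrix (Fin 4) (Fin 4) ℝ) (T S : Fin 4 → Fin 4 → Fin 4 → ℝ) : ℝ :=
  ∑ c, ∑ d, ∑ a, ∑ e, ∑ b, ∑ z, A c d * B a e * C b z * T e c b * S z d a

variable {A B C P H : Matrix (Fin 4) (Fin 4) ℝ} {T S : Fin 4 → Fin 4 → Fin 4 → ℝ}

/-- For totally skew arrays the first two contravariant slots are interchangeable: the relabelling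
produces one sign from each of `T` and `S`. -/
theorem torsionPairMulti_swap_left (hA : ∀ i j, A i j = A j i) (hB : ∀ i j, B i j = B j i)
    (hT : ∀ i j k, T i j k = -T j i k) (hS : ∀ i j k, S i j k = -S i k j) :
    torsionPairMulti A B C T S = torsionPairMulti B A C T S := by
  simp only [torsionPairMulti]
  rw [sum_six_nested, sum_six_nested]
  refine Fintype.sum_equiv ⟨fun p => (p.2.2.2.1, p.2.2.1, p.2.1, p.1, p.2.2.2.2),
    fun p => (p.2.2.2.1, p.2.2.1, p.2.1, p.1, p.2.2.2.2), fun _ => rfl, fun _ => rfl⟩ _ _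
    fun p => ?_
  simp only [Equiv.coe_fn_mk]
  rw [hT p.1, hS _ p.2.2.1, hA p.2.1, hB p.2.2.2.1]
  ring

/-- For totally skew arrays the outer contravariant slots are interchangeable. -/
theorem torsionPairMulti_swap_outer (hT : ∀ i j k, T i j k = -T i k j)
    (hS : ∀ i j k, S i j k = -S j i k) :
    torsionPairMulti A B C T S = torsionPairMulti C B A T S := by
  simp only [torsionPairMulti]
  rw [sum_six_nested, sum_six_nested]
  refine Fintype.sum_equiv
    ⟨fun p => (p.2.2.2.2.1, p.2.2.2.2.2, p.2.2.1, p.2.2.2.1, p.1, p.2.1),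
    fun p => (p.2.2.2.2.1, p.2.2.2.2.2, p.2.2.1, p.2.2.2.1, p.1, p.2.1), fun _ => rfl,
    fun _ => rfl⟩ _ _ fun p => ?_
  simp only [Equiv.coe_fn_mk]
  rw [hT _ p.1, hS p.2.2.2.2.2]
  ring

theorem torsionPair_comm (hP : ∀ i j, P i j = P j i) :
    torsionPair P T S = torsionPair P S T := by
  simp only [torsionPair]
  rw [sum_six_nested, sum_six_nested]
  refine Fintype.sum_equiv
    ⟨fun p => (p.2.1, p.1, p.2.2.2.2.1, p.2.2.2.2.2, p.2.2.1, p.2.2.2.1),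
    fun p => (p.2.1, p.1, p.2.2.2.2.1, p.2.2.2.2.2, p.2.2.1, p.2.2.2.1), fun _ => rfl,
    fun _ => rfl⟩ _ _ fun p => ?_
  simp only [Equiv.coe_fn_mk]
  rw [hP p.1]
  ring

theorem hasDerivAt_torsionPair {P : ℝ → Matrix (Fin 4) (Fin 4) ℝ}
    {T : ℝ → Fin 4 → Fin 4 → Fin 4 → ℝ} {P' : Matrix (Fin 4) (Fin 4) ℝ}
    {T' : Fin 4 → Fin 4 → Fin 4 → ℝ} {t : ℝ}
    (hP : ∀ i j, HasDerivAt (fun s => P s i j) (P' i j) t)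
    (hT : ∀ i j k, HasDerivAt (fun s => T s i j k) (T' i j k) t) :
    HasDerivAt (fun s => torsionPair (P s) (T s) (T s))
      (torsionPairMulti P' (P t) (P t) (T t) (T t) + torsionPairMulti (P t) P' (P t) (T t) (T t)
        + torsionPairMulti (P t) (P t) P' (T t) (T t) + torsionPair (P t) T' (T t)
        + torsionPair (P t) (T t) T') t := by
  simp only [torsionPair, torsionPairMulti, ← Finset.sum_add_distrib]
  refine HasDerivAt.fun_sum fun c _ => HasDerivAt.fun_sum fun d _ => HasDerivAt.fun_sum fun a _ =>
    HasDerivAt.fun_sum fun e _ => HasDerivAt.fun_sum fun b _ => HasDerivAt.fun_sum fun z _ => ?_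
  refine (((((hP c d).fun_mul (hP a e)).fun_mul (hP b z)).fun_mul (hT e c b)).fun_mul
    (hT z d a)).congr_deriv ?_
  ring

/-- The contraction of `τ` with a symmetric array: `τ` is the symmetrization of the coefficient
array of `δg^{cd}` in the torsion square. -/
theorem sum_tau_mul (g : Field2) (x : Coord) (hH : ∀ i j, H i j = H j i) :
    ∑ i, ∑ j, tau g i j x * H i j =
      torsionPairMulti H (gInv g x) (gInv g x) (torsionLow g x) (torsionLow g x) := by
  set B : Fin 4 → Fin 4 → ℝ := fun c d => ∑ a, ∑ e, ∑ b, ∑ z,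
    gInv g x a e * gInv g x b z * torsionLow g x e c b * torsionLow g x z d a with hB
  have h1 : ∀ i j, tau g i j x = (1 / 2) * (B i j + B j i) := by
    intro i j
    have : tau g i j x = ∑ c, ∑ d, symDelta c d i j * B c d := by
      simp only [tau, hB, Finset.mul_sum, mul_assoc]
    rw [this]
    simp only [symDelta, ite_and, mul_add, add_mul, Finset.sum_add_distrib]
    simp
  have h2 : torsionPairMulti H (gInv g x) (gInv g x) (torsionLow g x) (torsionLow g x) =
      ∑ i, ∑ j, B i j * H i j := by
    simp only [torsionPairMulti, hB, Finset.sum_mul]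
    refine Finset.sum_congr rfl fun c _ => Finset.sum_congr rfl fun d _ =>
      Finset.sum_congr rfl fun a _ => Finset.sum_congr rfl fun e _ =>
      Finset.sum_congr rfl fun b _ => Finset.sum_congr rfl fun z _ => ?_
    ring
  have h3 : ∑ i, ∑ j, B j i * H i j = ∑ i, ∑ j, B i j * H i j := by
    rw [Finset.sum_comm]
    simp only [fun i j => hH j i]
  rw [h2]
  simp only [h1, mul_add, add_mul, Finset.sum_add_distrib, mul_assoc, ← Finset.mul_sum, h3]
  ring

end TorsionPairing

/-! ### Smooth families of metrics -/

section MetricFamilies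

/-- A one-parameter family of non-symmetric metrics that is jointly smooth, with non-degenerate
symmetric part, on the open set `O` of pairs (parameter, point). -/
structure SmoothMetricFamily (O : Set (ℝ × Coord)) (γ : ℝ → Field2) : Prop where
  isOpen : IsOpen O
  smooth : ∀ i j, SmoothFamily O (fun s x => γ s x i j)
  det_ne : ∀ s x, (s, x) ∈ O → (symPart (γ s) x).det ≠ 0

namespace SmoothMetricFamily

variable {O : Set (ℝ × Coord)} {γ : ℝ → Field2} (hγ : SmoothMetricFamily O γ)
include hγ

theorem differentiableAt {s : ℝ} {x : Coord} (hq : (s, x) ∈ O) (i j : Fin 4) :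
    DifferentiableAt ℝ (fun y => γ s y i j) x :=
  differentiableAt_of_contDiffOn (isOpen_slice hγ.isOpen s) ((hγ.smooth i j).slice s) hq

theorem symPart (i j : Fin 4) : SmoothFamily O (fun s x => symPart (γ s) x i j) := by
  simp only [symPart_apply]
  exact (SmoothFamily.const _).mul ((hγ.smooth i j).add (hγ.smooth j i))

theorem gInv (i j : Fin 4) : SmoothFamily O (fun s x => gInv (γ s) x i j) :=
  contDiffOn_inv_matrix (M := fun q : ℝ × Coord => GenRiem.symPart (γ q.1) q.2) hγ.symPart
    (fun q hq => hγ.det_ne q.1 q.2 hq) i j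

theorem volDensity : SmoothFamily O (fun s x => volDensity (γ s) x) :=
  contDiffOn_sqrt_abs
    (contDiffOn_det (M := fun q : ℝ × Coord => GenRiem.symPart (γ q.1) q.2) hγ.symPart)
    (fun q hq => hγ.det_ne q.1 q.2 hq)

theorem pd_entry (k i j : Fin 4) : SmoothFamily O (fun s x => pd k (fun y => γ s y i j) x) :=
  (hγ.smooth i j).pd hγ.isOpen k

theorem christoffel (i j k : Fin 4) : SmoothFamily O (fun s x => christoffel (γ s) i j k x) :=
  (SmoothFamily.const _).mul (SmoothFamily.sum fun a => (hγ.gInv i a).mul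
    (((hγ.pd_entry k j a).sub (hγ.pd_entry a j k)).add (hγ.pd_entry j a k)))

theorem christoffelSym (i j k : Fin 4) :
    SmoothFamily O (fun s x => christoffelSym (γ s) i j k x) :=
  (SmoothFamily.const _).mul ((hγ.christoffel i j k).add (hγ.christoffel i k j))

theorem torsion (i j k : Fin 4) : SmoothFamily O (fun s x => torsion (γ s) i j k x) :=
  (SmoothFamily.const _).mul ((SmoothFamily.const _).mul
    ((hγ.christoffel i j k).sub (hγ.christoffel i k j)))

theorem torsionLow (i j k : Fin 4) : SmoothFamily O (fun s x => torsionLow (γ s) x i j k) :=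
  SmoothFamily.sum fun a => (hγ.symPart i a).mul (hγ.torsion a j k)

theorem riemann (i j m n : Fin 4) : SmoothFamily O (fun s x => riemann (γ s) i j m n x) :=
  ((((hγ.christoffelSym i j m).pd hγ.isOpen n).sub
    ((hγ.christoffelSym i j n).pd hγ.isOpen m)).add
    (SmoothFamily.sum fun a => (hγ.christoffelSym a j m).mul (hγ.christoffelSym i a n))).sub
    (SmoothFamily.sum fun a => (hγ.christoffelSym a j n).mul (hγ.christoffelSym i a m))

theorem ricci (i j : Fin 4) : SmoothFamily O (fun s x => ricci (γ s) i j x) :=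
  SmoothFamily.sum fun a => hγ.riemann a i j a

theorem scalarCurv : SmoothFamily O (fun s x => scalarCurv (γ s) x) :=
  SmoothFamily.sum fun i => SmoothFamily.sum fun j => (hγ.gInv i j).mul (hγ.ricci i j)

theorem torsionSq : SmoothFamily O (fun s x => torsionSq (γ s) x) := by
  simp only [GenRiem.torsionSq, torsionPair]
  exact SmoothFamily.sum fun c => SmoothFamily.sum fun d => SmoothFamily.sum fun a =>
    SmoothFamily.sum fun e => SmoothFamily.sum fun b => SmoothFamily.sum fun z =>
    ((((hγ.gInv c d).mul (hγ.gInv a e)).mul (hγ.gInv b z)).mul (hγ.torsionLow e c b)).mul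
      (hγ.torsionLow z d a)

theorem tau (i j : Fin 4) : SmoothFamily O (fun s x => tau (γ s) i j x) :=
  SmoothFamily.sum fun c => SmoothFamily.sum fun d => SmoothFamily.sum fun a =>
    SmoothFamily.sum fun e => SmoothFamily.sum fun b => SmoothFamily.sum fun z =>
    ((((SmoothFamily.const (symDelta c d i j)).mul (hγ.gInv a e)).mul (hγ.gInv b z)).mul
      (hγ.torsionLow e c b)).mul (hγ.torsionLow z d a)

theorem scalarFamily_eq {s : ℝ} {x : Coord} (hq : (s, x) ∈ O) (c : Coeffs) :
    scalarFamily c (γ s) x =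
      GenRiem.scalarCurv (γ s) x - (c.v' + c.w) * GenRiem.torsionSq (γ s) x :=
  GenRiem.scalarFamily_eq (hγ.det_ne s x hq) (fun i j k => differentiableAt_of_contDiffOn
    (isOpen_slice hγ.isOpen s) ((hγ.torsion i j k).slice s) hq) c

theorem action_density (c : Coeffs) (Lam : ℝ) : SmoothFamily O
    (fun s x => GenRiem.volDensity (γ s) x * (scalarFamily c (γ s) x - 2 * Lam)) :=
  (hγ.volDensity.mul ((hγ.scalarCurv.sub ((SmoothFamily.const (c.v' + c.w)).mul
    hγ.torsionSq)).sub (SmoothFamily.const (2 * Lam)))).congr fun s x hq => by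
      rw [hγ.scalarFamily_eq hq]

end SmoothMetricFamily

/-- A single smooth metric on `U`, regarded as a constant family. -/
theorem smoothMetricFamily_const {U : Set Coord} (hU : IsOpen U) {g : Field2}
    (hg : ∀ i j, ContDiffOn ℝ ∞ (fun x => g x i j) U)
    (hdet : ∀ x ∈ U, (symPart g x).det ≠ 0) :
    SmoothMetricFamily {q : ℝ × Coord | q.2 ∈ U} (fun _ => g) where
  isOpen := hU.preimage continuous_snd
  smooth i j := (hg i j).comp contDiff_snd.contDiffOn fun _ hq => hq
  det_ne _ x hx := hdet x hx

end MetricFamilies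

/-! ### The Palatini identity -/

section Palatini

variable {O : Set (ℝ × Coord)} {γ : ℝ → Field2}

/-- The variation of the Levi-Civita connection along a family of metrics. -/
def connDot (γ : ℝ → Field2) (i j k : Fin 4) : Coord → ℝ :=
  sdot (fun s => christoffelSym (γ s) i j k)

theorem connDot_symm (γ : ℝ → Field2) (i j k : Fin 4) (x : Coord) :
    connDot γ i j k x = connDot γ i k j x := by
  simp only [connDot, sdot, fun s => christoffelSym_symm (γ s) i j k x]

/-- The vector density `√|g| (g^{ij} δΓ^k_{ij} - g^{ik} δΓ^a_{ia})` whose divergence is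
`√|g| g^{ij} δR_{ij}`. -/
def palatiniField (γ : ℝ → Field2) (k : Fin 4) (x : Coord) : ℝ :=
  volDensity (γ 0) x * (∑ i, ∑ j, gInv (γ 0) x i j * connDot γ k i j x
    - ∑ i, gInv (γ 0) x i k * ∑ a, connDot γ a i a x)

/-- The variation of the Ricci tensor in terms of the variation of the connection. -/
def ricciDot (γ : ℝ → Field2) (i j : Fin 4) (x : Coord) : ℝ :=
  (∑ a, pd a (connDot γ a i j) x) - (∑ a, pd j (connDot γ a i a) x)
    + (∑ a, ∑ b, (connDot γ b i j x * christoffelSym (γ 0) a b a x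
      + christoffelSym (γ 0) b i j x * connDot γ a b a x))
    - ∑ a, ∑ b, (connDot γ b i a x * christoffelSym (γ 0) a b j x
      + christoffelSym (γ 0) b i a x * connDot γ a b j x)

namespace SmoothMetricFamily

variable (hγ : SmoothMetricFamily O γ) {x : Coord} (hx : ((0 : ℝ), x) ∈ O)
include hγ hx

theorem hasDerivAt_christoffelSym (i j k : Fin 4) :
    HasDerivAt (fun s => GenRiem.christoffelSym (γ s) i j k x) (connDot γ i j k x) 0 :=
  (hγ.christoffelSym i j k).hasDerivAt hγ.isOpen hx

theorem hasDerivAt_ricci (i j : Fin 4) :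
    HasDerivAt (fun s => GenRiem.ricci (γ s) i j x) (ricciDot γ i j x) 0 := by
  have hpd : ∀ n i j k, HasDerivAt (fun s => pd n (GenRiem.christoffelSym (γ s) i j k) x)
      (pd n (connDot γ i j k) x) 0 := fun n i j k =>
    (hγ.christoffelSym i j k).hasDerivAt_pd hγ.isOpen n hx
  have h : HasDerivAt (fun s => GenRiem.ricci (γ s) i j x) _ 0 :=
    HasDerivAt.fun_sum fun a _ =>
      (((hpd a a i j).fun_sub (hpd j a i a)).fun_add (HasDerivAt.fun_sum fun b _ =>
        (hγ.hasDerivAt_christoffelSym hx b i j).fun_mul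
          (hγ.hasDerivAt_christoffelSym hx a b a))).fun_sub (HasDerivAt.fun_sum fun b _ =>
        (hγ.hasDerivAt_christoffelSym hx b i a).fun_mul
          (hγ.hasDerivAt_christoffelSym hx a b j))
  refine h.congr_deriv ?_
  simp only [ricciDot, Finset.sum_add_distrib, Finset.sum_sub_distrib]

/-- The Palatini identity `√|g| g^{ij} δR_{ij} = ∂_k X^k`. -/
theorem sum_pd_palatiniField :
    ∑ k, pd k (palatiniField γ k) x =
      GenRiem.volDensity (γ 0) x * ∑ i, ∑ j, GenRiem.gInv (γ 0) x i j * ricciDot γ i j x := by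
  have hd : ∀ {f : Coord → ℝ}, ContDiffOn ℝ ∞ f {y | ((0 : ℝ), y) ∈ O} →
      DifferentiableAt ℝ f x := fun hf =>
    differentiableAt_of_contDiffOn (isOpen_slice hγ.isOpen 0) hf hx
  have hvol : DifferentiableAt ℝ (GenRiem.volDensity (γ 0)) x := hd (hγ.volDensity.slice 0)
  have hP : ∀ i j, DifferentiableAt ℝ (fun y => GenRiem.gInv (γ 0) y i j) x := fun i j =>
    hd ((hγ.gInv i j).slice 0)
  have hC : ∀ i j k, DifferentiableAt ℝ (connDot γ i j k) x := fun i j k =>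
    hd ((hγ.christoffelSym i j k).contDiffOn_sdot hγ.isOpen)
  have hdet := hγ.det_ne 0 x hx
  have hg := hγ.differentiableAt hx
  have hCs : ∀ i, DifferentiableAt ℝ (fun y => ∑ a, connDot γ a i a y) x := fun i =>
    DifferentiableAt.fun_sum fun a _ => hC a i a
  have hX : ∀ k, pd k (palatiniField γ k) x =
      GenRiem.volDensity (γ 0) x * (((∑ i, ∑ j,
        ((-(∑ b, GenRiem.christoffelSym (γ 0) i b k x * GenRiem.gInv (γ 0) x b j)
          - ∑ b, GenRiem.gInv (γ 0) x i b * GenRiem.christoffelSym (γ 0) j b k x)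
            * connDot γ k i j x
          + GenRiem.gInv (γ 0) x i j * pd k (connDot γ k i j) x))
        - ∑ i, ((-(∑ b, GenRiem.christoffelSym (γ 0) i b k x * GenRiem.gInv (γ 0) x b k)
          - ∑ b, GenRiem.gInv (γ 0) x i b * GenRiem.christoffelSym (γ 0) k b k x)
            * ∑ a, connDot γ a i a x
          + GenRiem.gInv (γ 0) x i k * ∑ a, pd k (connDot γ a i a) x))
        + (∑ a, GenRiem.christoffelSym (γ 0) a a k x) *
          (∑ i, ∑ j, GenRiem.gInv (γ 0) x i j * connDot γ k i j x
            - ∑ i, GenRiem.gInv (γ 0) x i k * ∑ a, connDot γ a i a x)) := by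
    intro k
    have hPC : ∀ i j, DifferentiableAt ℝ
        (fun y => GenRiem.gInv (γ 0) y i j * connDot γ k i j y) x := fun i j =>
      (hP i j).fun_mul (hC k i j)
    have hPC' : ∀ i, DifferentiableAt ℝ
        (fun y => GenRiem.gInv (γ 0) y i k * ∑ a, connDot γ a i a y) x := fun i =>
      (hP i k).fun_mul (hCs i)
    have hsum : DifferentiableAt ℝ
        (fun y => ∑ i, ∑ j, GenRiem.gInv (γ 0) y i j * connDot γ k i j y) x :=
      DifferentiableAt.fun_sum fun i _ => DifferentiableAt.fun_sum fun j _ => hPC i j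
    have hsum' : DifferentiableAt ℝ
        (fun y => ∑ i, GenRiem.gInv (γ 0) y i k * ∑ a, connDot γ a i a y) x :=
      DifferentiableAt.fun_sum fun i _ => hPC' i
    have e1 : pd k (palatiniField γ k) x = _ := pd_mul hvol (hsum.fun_sub hsum')
    rw [e1, pd_sub hsum hsum', pd_volDensity hdet hg hvol, pd_sum fun i => hPC' i,
      pd_sum fun i => DifferentiableAt.fun_sum fun j _ => hPC i j]
    simp only [pd_sum fun j => hPC _ j, pd_mul (hP _ _) (hC _ _ _), pd_mul (hP _ _) (hCs _),
      pd_sum fun a => hC a _ a, pd_gInv hdet hg hP]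
    ring
  simp only [hX, ← Finset.mul_sum]
  rw [palatini_algebra (gInv_symm (γ 0) x) (fun i j k => christoffelSym_symm (γ 0) i j k x)
    (fun i j k => connDot_symm γ i j k x) (dC := fun k a i j => pd k (connDot γ a i j) x)]
  rfl

omit hx in
theorem contDiffOn_palatiniField (k : Fin 4) :
    ContDiffOn ℝ ∞ (palatiniField γ k) {y | ((0 : ℝ), y) ∈ O} := by
  have hC : ∀ i j k, ContDiffOn ℝ ∞ (connDot γ i j k) {y | ((0 : ℝ), y) ∈ O} := fun i j k =>
    (hγ.christoffelSym i j k).contDiffOn_sdot hγ.isOpen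
  have hP : ∀ i j, ContDiffOn ℝ ∞ (fun y => GenRiem.gInv (γ 0) y i j) {y | ((0 : ℝ), y) ∈ O} :=
    fun i j => (hγ.gInv i j).slice 0
  exact (hγ.volDensity.slice 0).mul
    ((ContDiffOn.sum fun i _ => ContDiffOn.sum fun j _ => (hP i j).mul (hC k i j)).sub
      (ContDiffOn.sum fun i _ => (hP i k).mul (ContDiffOn.sum fun a _ => hC a i a)))

/-- The connection does not vary near a point where the symmetric part of the metric does not. -/
theorem connDot_eq_zero
    (h : ∀ᶠ q in 𝓝 ((0 : ℝ), x), GenRiem.symPart (γ q.1) q.2 = GenRiem.symPart (γ 0) q.2)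
    (i j k : Fin 4) : connDot γ i j k x = 0 := by
  have h1 : (fun s => GenRiem.christoffelSym (γ s) i j k x) =ᶠ[𝓝 0]
      fun _ => GenRiem.christoffelSym (γ 0) i j k x := by
    have h2 := h.curry_nhds
    have h3 : ∀ᶠ s in 𝓝 (0 : ℝ), (s, x) ∈ O :=
      (by fun_prop : Continuous fun s : ℝ => (s, x)).continuousAt.eventually
        (hγ.isOpen.mem_nhds hx)
    filter_upwards [h2, h3] with s hs hsO
    rw [christoffelSym_eq (hγ.differentiableAt hsO), christoffelSym_eq (hγ.differentiableAt hx)]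
    have h4 : ∀ k i j, pd k (fun y => GenRiem.symPart (γ s) y i j) x =
        pd k (fun y => GenRiem.symPart (γ 0) y i j) x := fun k i j =>
      pd_congr (hs.mono fun y hy => by simp only [hy])
    have h5 : GenRiem.gInv (γ s) x = GenRiem.gInv (γ 0) x := by
      rw [GenRiem.gInv, hs.self_of_nhds]; rfl
    simp only [h4, h5]
  rw [connDot, sdot, h1.deriv_eq, deriv_const]

end SmoothMetricFamily

end Palatini

/-! ### Locality of the geometric quantities -/

section Locality

variable {U : Set Coord} {g g' : Field2}

theorem symPart_congr {x : Coord} (h : g x = g' x) : symPart g x = symPart g' x := by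
  simp only [symPart, h]

theorem gInv_congr {x : Coord} (h : g x = g' x) : gInv g x = gInv g' x := by
  simp only [gInv, symPart_congr h]

theorem volDensity_congr {x : Coord} (h : g x = g' x) : volDensity g x = volDensity g' x := by
  simp only [volDensity, symPart_congr h]

theorem christoffel_congr (hU : IsOpen U) (h : EqOn g g' U) (i j k : Fin 4) :
    EqOn (christoffel g i j k) (christoffel g' i j k) U := by
  intro x hx
  have h1 : ∀ n a b, pd n (fun y => g y a b) x = pd n (fun y => g' y a b) x := fun n a b =>
    pd_congr ((h.eventuallyEq_of_mem (hU.mem_nhds hx)).mono fun y hy => by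
      simp only [hy])
  simp only [christoffel, h1, gInv_congr (h hx)]

theorem christoffelSym_congr (hU : IsOpen U) (h : EqOn g g' U) (i j k : Fin 4) :
    EqOn (christoffelSym g i j k) (christoffelSym g' i j k) U := fun x hx => by
  simp only [christoffelSym, christoffel_congr hU h _ _ _ hx]

theorem torsionLow_congr (hU : IsOpen U) (h : EqOn g g' U) {x : Coord} (hx : x ∈ U) :
    torsionLow g x = torsionLow g' x := by
  funext i j k
  simp only [torsionLow, torsion, christoffelSkew, christoffel_congr hU h _ _ _ hx,
    symPart_congr (h hx)]

theorem torsionSq_congr (hU : IsOpen U) (h : EqOn g g' U) {x : Coord} (hx : x ∈ U) :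
    torsionSq g x = torsionSq g' x := by
  rw [torsionSq, torsionSq, torsionLow_congr hU h hx, gInv_congr (h hx)]

theorem ricci_congr (hU : IsOpen U) (h : EqOn g g' U) (i j : Fin 4) :
    EqOn (ricci g i j) (ricci g' i j) U := by
  intro x hx
  have h1 : ∀ n a b c, pd n (christoffelSym g a b c) x = pd n (christoffelSym g' a b c) x :=
    fun n a b c =>
      pd_congr ((christoffelSym_congr hU h a b c).eventuallyEq_of_mem (hU.mem_nhds hx))
  simp only [ricci, riemann, h1, christoffelSym_congr hU h _ _ _ hx]

theorem scalarCurv_congr (hU : IsOpen U) (h : EqOn g g' U) {x : Coord} (hx : x ∈ U) :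
    scalarCurv g x = scalarCurv g' x := by
  simp only [scalarCurv, ricci_congr hU h _ _ hx, gInv_congr (h hx)]

end Locality

/-! ### The varied metrics -/

section VariedMetric

variable {U : Set Coord} {g : Field2} {A : Field2 → Field2} {D : Set Coord} {h : Field2}

/-- The unvaried metric, on `U` only: elsewhere neither the invertibility of the symmetric part nor
the value of the rule `A` is known. -/
theorem varied_zero (hdet : ∀ x ∈ U, (symPart g x).det ≠ 0) (hA : IsSkewRule U g A) :
    EqOn (varied g A h 0) g U := by
  intro x hx
  have h1 : A (fun y => gInv g y) x = skewPart g x := hA.base x hx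
  simp only [varied, zero_smul, add_zero, h1]
  rw [gInv, Matrix.nonsing_inv_nonsing_inv _ (isUnit_iff_ne_zero.mpr (hdet x hx)), symPart,
    skewPart]
  ext i j
  simp only [Matrix.add_apply, Matrix.smul_apply, Matrix.sub_apply, Matrix.transpose_apply,
    smul_eq_mul]
  ring

theorem symPart_add_of_skew {S B : Matrix (Fin 4) (Fin 4) ℝ} (hS : S.transpose = S)
    (hB : B.transpose = -B) : (1 / 2 : ℝ) • ((S + B) + (S + B).transpose) = S := by
  rw [Matrix.transpose_add, hS, hB]
  ext i j
  simp only [Matrix.add_apply, Matrix.smul_apply, Matrix.neg_apply, smul_eq_mul]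
  ring

/-- The varied metrics form a smooth family on an open set that contains `{0} × U`; it consists
of the pairs at which the varied contravariant symmetric part stays invertible. -/
theorem exists_smoothMetricFamily_varied (hU : IsOpen U)
    (hg : ∀ i j, ContDiffOn ℝ ∞ (fun x => g x i j) U)
    (hdet : ∀ x ∈ U, (symPart g x).det ≠ 0) (hA : IsSkewRule U g A)
    (hD : IsCompact D) (hDU : D ⊆ U) (hh : IsVariation D h) :
    ∃ O : Set (ℝ × Coord), SmoothMetricFamily O (varied g A h) ∧
      (∀ x ∈ U, ((0 : ℝ), x) ∈ O) ∧ (∀ s x, (s, x) ∈ O → x ∈ U) ∧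
      (∀ s x, (s, x) ∈ O → (gInv g x + s • h x).det ≠ 0) ∧
      ∀ s x, (s, x) ∈ O → symPart (varied g A h s) x = (gInv g x + s • h x)⁻¹ := by
  obtain ⟨r, hr, hskew, hsm⟩ := hA.along D h hD hDU hh
  set I : Set (ℝ × Coord) := Ioo (-r) r ×ˢ U with hI
  have hIo : IsOpen I := isOpen_Ioo.prod hU
  have hP : ∀ i j, ContDiffOn ℝ ∞ (fun x => gInv g x i j) U := fun i j =>
    contDiffOn_inv_matrix (fun i j => by
      simp only [symPart_apply]
      exact contDiffOn_const.mul ((hg i j).add (hg j i))) hdet i j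
  have hG : ∀ i j, ContDiffOn ℝ ∞
      (fun q : ℝ × Coord => (gInv g q.2 + q.1 • h q.2) i j) I := fun i j => by
    simp only [Matrix.add_apply, Matrix.smul_apply, smul_eq_mul]
    exact ((hP i j).comp contDiff_snd.contDiffOn fun q hq => hq.2).add
      (contDiff_fst.contDiffOn.mul ((hh.smooth i j).comp contDiff_snd).contDiffOn)
  set O : Set (ℝ × Coord) := I ∩ (fun q : ℝ × Coord => (gInv g q.2 + q.1 • h q.2).det) ⁻¹' {0}ᶜ
    with hO
  have hOI : O ⊆ I := inter_subset_left
  have hOo : IsOpen O :=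
    (contDiffOn_det hG).continuousOn.isOpen_inter_preimage hIo isOpen_compl_singleton
  have hOdet : ∀ q ∈ O, (gInv g q.2 + q.1 • h q.2).det ≠ 0 := fun q hq => hq.2
  have hsym : ∀ s x, (s, x) ∈ O →
      symPart (varied g A h s) x = (gInv g x + s • h x)⁻¹ := by
    intro s x hq
    have h1 : (gInv g x + s • h x).transpose = gInv g x + s • h x := by
      rw [Matrix.transpose_add, Matrix.transpose_smul, gInv_transpose, hh.symm]
    exact symPart_add_of_skew (by rw [Matrix.transpose_nonsing_inv, h1])
      (hskew s (hOI hq).1 x (hOI hq).2)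
  refine ⟨O, ⟨hOo, fun i j => ?_, fun s x hq => ?_⟩, fun x hx => ⟨⟨⟨neg_lt_zero.mpr hr, hr⟩, hx⟩,
    ?_⟩, fun s x hq => (hOI hq).2, fun s x hq => hOdet (s, x) hq, hsym⟩
  · have h1 := contDiffOn_inv_matrix (fun i j => (hG i j).mono hOI) hOdet i j
    exact h1.add ((hsm i j).mono hOI)
  · rw [hsym s x hq]
    exact (Matrix.isUnit_nonsing_inv_det _ (isUnit_iff_ne_zero.mpr (hOdet _ hq))).ne_zero
  · change (gInv g x + (0 : ℝ) • h x).det ∈ ({0} : Set ℝ)ᶜ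
    rw [zero_smul, add_zero]
    exact (Matrix.isUnit_nonsing_inv_det _ (isUnit_iff_ne_zero.mpr (hdet x hx))).ne_zero

end VariedMetric

/-! ### The first variation of the action -/

section ActionVariation

/-- The energy-momentum tensor `(v' + w) (3 τ_{ij} + 2 W_{ij} - 𝒬 g_{ij} / 2)`. -/
def torsionStress (c : Coeffs) (g W : Field2) : Field2 := fun x => Matrix.of fun i j =>
  (c.v' + c.w) * (3 * tau g i j x + 2 * W x i j - (1 / 2) * torsionSq g x * symPart g x i j)

variable {U : Set Coord} {g : Field2} {A : Field2 → Field2} {D : Set Coord} {h W : Field2}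

/-- The variation of the volume density is `δ√|g| = -½ √|g| g_{ij} δg^{ij}`. -/
theorem hasDerivAt_sqrt_det_inv_add_smul {P H : Matrix (Fin 4) (Fin 4) ℝ} (hP : P.det ≠ 0)
    (hH : H.transpose = H) :
    HasDerivAt (fun s : ℝ => Real.sqrt |((P + s • H)⁻¹).det|)
      (Real.sqrt |(P⁻¹).det| * (-(1 / 2) * ∑ i, ∑ j, P⁻¹ i j * H i j)) 0 := by
  have h0 : P + (0 : ℝ) • H = P := by simp
  have hu := isUnit_iff_ne_zero.mpr hP
  have hlin : ∀ i j, HasDerivAt (fun s : ℝ => (P + s • H) i j) (H i j) 0 := fun i j => by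
    simp only [Matrix.add_apply, Matrix.smul_apply, smul_eq_mul]
    simpa using ((hasDerivAt_id (0 : ℝ)).mul_const (H i j)).const_add (P i j)
  have h1 := hasDerivAt_sqrt_abs_det (M := fun s : ℝ => (P + s • H)⁻¹)
    (M' := -(P⁻¹ * H * P⁻¹)) (t := 0) (fun i j => by
      have := hasDerivAt_inv_matrix hlin (by rwa [h0]) i j
      rwa [h0] at this)
    (by rw [h0]; exact (Matrix.isUnit_nonsing_inv_det _ hu).ne_zero)
  rw [h0] at h1
  refine h1.congr_deriv ?_
  rw [Matrix.nonsing_inv_nonsing_inv _ hu, Matrix.mul_neg, Matrix.trace_neg, Matrix.mul_assoc P⁻¹,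
    ← Matrix.mul_assoc P, Matrix.mul_nonsing_inv _ hu, Matrix.one_mul, Matrix.trace_mul_comm]
  have h2 : (P⁻¹ * H).trace = ∑ i, ∑ j, P⁻¹ i j * H i j := by
    simp only [Matrix.trace, Matrix.diag_apply, Matrix.mul_apply]
    refine Finset.sum_congr rfl fun i _ => Finset.sum_congr rfl fun j _ => ?_
    rw [← hH, Matrix.transpose_apply, hH]
  rw [h2]; ring

/-- The first variation of the action. The curvature contributes the Einstein tensor up to the
divergence of `palatiniField`, which integrates to zero; each of the three contravariant metrics
in the torsion square contributes `τ`, and each of its two torsion factors contributes `W`. -/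
theorem hasDerivAt_action (hU : IsOpen U)
    (hg : ∀ i j, ContDiffOn ℝ ∞ (fun x => g x i j) U)
    (hdet : ∀ x ∈ U, (symPart g x).det ≠ 0) (hA : IsSkewRule U g A)
    (hW : IsTorsionVariation U g A W) (c : Coeffs) (Lam : ℝ)
    (hD : IsCompact D) (hDU : D ⊆ U) (hh : IsVariation D h) :
    HasDerivAt (fun s : ℝ => action c Lam D (varied g A h s))
      (∫ x in D, volDensity g x *
        ∑ i, ∑ j, (einsteinLam g Lam i j x - torsionStress c g W x i j) * h x i j) 0 := by
  obtain ⟨O, hγ, h0O, hOU, hOdet, hsym⟩ :=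
    exists_smoothMetricFamily_varied hU hg hdet hA hD hDU hh
  have hgc := smoothMetricFamily_const hU hg hdet
  set γ := varied g A h
  have hOo := hγ.isOpen
  have hγ0 : EqOn (γ 0) g U := varied_zero hdet hA
  have hhs : ∀ x i j, h x i j = h x j i := fun x i j => by
    conv_lhs => rw [← hh.symm x, Matrix.transpose_apply]
  have hinv : ∀ s x, (s, x) ∈ O → gInv (γ s) x = gInv g x + s • h x := fun s x hq => by
    rw [gInv, hsym s x hq,
      Matrix.nonsing_inv_nonsing_inv _ (isUnit_iff_ne_zero.mpr (hOdet s x hq))]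
  have hnear : ∀ x ∈ U, ∀ᶠ s in 𝓝 (0 : ℝ), (s, x) ∈ O := fun x hx =>
    (by fun_prop : Continuous fun s : ℝ => (s, x)).continuousAt.eventually
      (hOo.mem_nhds (h0O x hx))
  -- the parameter derivatives of the ingredients
  have dP : ∀ x ∈ U, ∀ i j, HasDerivAt (fun s => gInv (γ s) x i j) (h x i j) 0 := by
    intro x hx i j
    have h1 : HasDerivAt (fun s : ℝ => gInv g x i j + s * h x i j) (h x i j) 0 := by
      simpa using ((hasDerivAt_id (0 : ℝ)).mul_const (h x i j)).const_add (gInv g x i j)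
    refine h1.congr_of_eventuallyEq ?_
    filter_upwards [hnear x hx] with s hs
    rw [hinv s x hs]
    rfl
  have dvol : ∀ x ∈ U, HasDerivAt (fun s => volDensity (γ s) x)
      (volDensity g x * (-(1 / 2) * ∑ i, ∑ j, symPart g x i j * h x i j)) 0 := by
    intro x hx
    have hu := isUnit_iff_ne_zero.mpr (hdet x hx)
    have h1 := hasDerivAt_sqrt_det_inv_add_smul (P := gInv g x) (H := h x)
      (Matrix.isUnit_nonsing_inv_det _ hu).ne_zero (hh.symm x)
    have h2 : (gInv g x)⁻¹ = symPart g x := Matrix.nonsing_inv_nonsing_inv _ hu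
    rw [h2] at h1
    refine h1.congr_of_eventuallyEq ?_
    filter_upwards [hnear x hx] with s hs
    rw [volDensity, hsym s x hs]
  set T' : Coord → Fin 4 → Fin 4 → Fin 4 → ℝ := fun x i j k =>
    sdot (fun s x => torsionLow (γ s) x i j k) x with hT'
  have dT : ∀ x ∈ U, ∀ i j k, HasDerivAt (fun s => torsionLow (γ s) x i j k) (T' x i j k) 0 :=
    fun x hx i j k => (hγ.torsionLow i j k).hasDerivAt hOo (h0O x hx)
  have dR : ∀ x ∈ U, HasDerivAt (fun s => scalarCurv (γ s) x)
      (∑ i, ∑ j, (h x i j * ricci g i j x + gInv (γ 0) x i j * ricciDot γ i j x)) 0 := by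
    intro x hx
    refine HasDerivAt.fun_sum fun i _ => HasDerivAt.fun_sum fun j _ => ?_
    rw [← ricci_congr hU hγ0 i j hx]
    exact (dP x hx i j).fun_mul (hγ.hasDerivAt_ricci (h0O x hx) i j)
  have dQ : ∀ x ∈ U, HasDerivAt (fun s => torsionSq (γ s) x)
      (3 * (∑ i, ∑ j, tau g i j x * h x i j)
        + 2 * torsionPair (gInv g x) (T' x) (torsionLow g x)) 0 := by
    intro x hx
    have hP := gInv_symm g x
    have hl : ∀ i j k, torsionLow g x i j k = -torsionLow g x j i k := fun i j k => by
      simp only [torsionLow_eq_skewCurl (hdet x hx)]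
      exact skewCurl_swap_left g x i j k
    have hr : ∀ i j k, torsionLow g x i j k = -torsionLow g x i k j := fun i j k => by
      simp only [torsionLow_eq_skewCurl (hdet x hx)]
      exact skewCurl_swap_right g x i j k
    refine (hasDerivAt_torsionPair (dP x hx) (dT x hx)).congr_deriv ?_
    rw [gInv_congr (hγ0 hx), torsionLow_congr hU hγ0 hx, sum_tau_mul g x (hhs x),
      torsionPairMulti_swap_left (A := gInv g x) hP (hhs x) hl hr,
      torsionPairMulti_swap_outer (C := h x) hr hl,
      torsionPair_comm (T := torsionLow g x) (S := T' x) hP]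
    ring
  -- differentiation under the integral sign
  have key := hasDerivAt_setIntegral_of_smoothFamily hOo hD (fun x hx => h0O x (hDU hx))
    (hγ.action_density c Lam)
    (F' := fun x => volDensity g x * (∑ i, ∑ j, (ricci g i j x
        - (1 / 2) * scalarCurv g x * symPart g x i j + Lam * symPart g x i j
        - (c.v' + c.w) * (3 * tau g i j x - (1 / 2) * torsionSq g x * symPart g x i j)) * h x i j)
      + ∑ k, pd k (palatiniField γ k) x
      - 2 * (c.v' + c.w) * (volDensity g x *
          torsionPair (gInv g x) (T' x) (torsionLow g x))) (fun x hxD => by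
    have hx := hDU hxD
    have h1 : HasDerivAt (fun s => volDensity (γ s) x *
        (scalarCurv (γ s) x - (c.v' + c.w) * torsionSq (γ s) x - 2 * Lam)) _ 0 :=
      (dvol x hx).fun_mul (((dR x hx).fun_sub ((dQ x hx).const_mul (c.v' + c.w))).sub_const
        (2 * Lam))
    have h2 : HasDerivAt (fun s => volDensity (γ s) x *
        (scalarFamily c (γ s) x - 2 * Lam)) _ 0 := h1.congr_of_eventuallyEq (by
      filter_upwards [hnear x hx] with s hs
      rw [hγ.scalarFamily_eq hs])
    refine h2.congr_deriv ?_
    rw [hγ.sum_pd_palatiniField (h0O x hx), volDensity_congr (hγ0 hx),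
      scalarCurv_congr hU hγ0 hx, torsionSq_congr hU hγ0 hx]
    have hs2 : ∑ i, ∑ j, (ricci g i j x
        - (1 / 2) * scalarCurv g x * symPart g x i j + Lam * symPart g x i j
        - (c.v' + c.w) * (3 * tau g i j x - (1 / 2) * torsionSq g x * symPart g x i j)) * h x i j
        = ∑ i, ∑ j, ricci g i j x * h x i j
          + (-((1 / 2) * scalarCurv g x) + Lam + (c.v' + c.w) * ((1 / 2) * torsionSq g x))
            * ∑ i, ∑ j, symPart g x i j * h x i j
          - 3 * (c.v' + c.w) * ∑ i, ∑ j, tau g i j x * h x i j := by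
      simp only [Finset.mul_sum]
      rw [← Finset.sum_add_distrib, ← Finset.sum_sub_distrib]
      refine Finset.sum_congr rfl fun i _ => ?_
      rw [← Finset.sum_add_distrib, ← Finset.sum_sub_distrib]
      refine Finset.sum_congr rfl fun j _ => ?_
      ring
    have hs3 : ∑ i, ∑ j, h x i j * ricci g i j x = ∑ i, ∑ j, ricci g i j x * h x i j := by
      simp only [mul_comm]
    rw [hs2]
    simp only [Finset.sum_add_distrib, hs3]
    ring)
  -- the torsion term is the one represented by `W`
  have hTW : ∫ x in D, volDensity g x * torsionPair (gInv g x) (T' x) (torsionLow g x) =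
      ∫ x in D, volDensity g x * ∑ i, ∑ j, W x i j * h x i j := by
    refine HasDerivAt.unique ?_ (hW.deriv D h hD hDU hh)
    have hsub : O ⊆ {q : ℝ × Coord | q.2 ∈ U} := fun q hq => hOU q.1 q.2 hq
    refine hasDerivAt_setIntegral_of_smoothFamily hOo hD (fun x hx => h0O x (hDU hx))
      (F := fun s x => volDensity g x *
        torsionPair (gInv g x) (torsionLow (γ s) x) (torsionLow g x)) ?_ fun x hx => ?_
    · simp only [torsionPair]
      exact SmoothFamily.mul (hgc.volDensity.mono hsub)
        (SmoothFamily.sum fun c => SmoothFamily.sum fun d => SmoothFamily.sum fun a =>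
          SmoothFamily.sum fun e => SmoothFamily.sum fun b => SmoothFamily.sum fun z =>
          SmoothFamily.mul (SmoothFamily.mul (SmoothFamily.mul (SmoothFamily.mul
            ((hgc.gInv c d).mono hsub) ((hgc.gInv a e).mono hsub)) ((hgc.gInv b z).mono hsub))
            (hγ.torsionLow e c b)) ((hgc.torsionLow z d a).mono hsub))
    · simp only [torsionPair]
      exact HasDerivAt.const_mul _ (HasDerivAt.fun_sum fun c _ => HasDerivAt.fun_sum fun d _ =>
        HasDerivAt.fun_sum fun a _ => HasDerivAt.fun_sum fun e _ => HasDerivAt.fun_sum fun b _ =>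
        HasDerivAt.fun_sum fun z _ =>
          ((dT x (hDU hx) e c b).const_mul _).mul_const _)
  -- the divergence integrates to zero
  have hUO : U ⊆ {y | ((0 : ℝ), y) ∈ O} := h0O
  have hXs : ∀ k, ContDiffOn ℝ ∞ (palatiniField γ k) U := fun k =>
    (hγ.contDiffOn_palatiniField k).mono hUO
  have hX0 : ∀ k, ∀ x ∈ U, x ∉ D → palatiniField γ k x = 0 := by
    intro k x hx hxD
    have hC := hγ.connDot_eq_zero (h0O x hx) (by
      have h1 : ∀ᶠ q in 𝓝 ((0 : ℝ), x), q.2 ∈ Dᶜ :=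
        continuous_snd.continuousAt.eventually (hD.isClosed.isOpen_compl.mem_nhds hxD)
      filter_upwards [h1, hOo.mem_nhds (h0O x hx)] with q hqD hqO
      have hqU := hOU q.1 q.2 hqO
      rw [hsym q.1 q.2 hqO, hsym 0 q.2 (h0O _ hqU), hh.vanish q.2 hqD, smul_zero, smul_zero])
    simp only [palatiniField, hC, mul_zero, Finset.sum_const_zero, sub_zero]
  have hdiv : ∀ k, ∫ x in D, pd k (palatiniField γ k) x = 0 := fun k =>
    setIntegral_pd_eq_zero hU hD hDU (hXs k) (hX0 k) k
  -- integrability over the compact set `D`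
  have hint : ∀ {f : Coord → ℝ}, ContinuousOn f U → Integrable f (volume.restrict D) :=
    fun hf => (hf.mono hDU).integrableOn_compact hD
  have hc : ∀ {f : Coord → ℝ}, SmoothFamily {q : ℝ × Coord | q.2 ∈ U} (fun _ => f) →
      ContinuousOn f U := fun hf => (hf.slice 0).continuousOn
  have hhc : ∀ i j, ContinuousOn (fun x => h x i j) U := fun i j =>
    (hh.smooth i j).continuous.continuousOn
  have hvolc := hc hgc.volDensity
  have hi1 : Integrable (fun x => volDensity g x * (∑ i, ∑ j, (ricci g i j x
        - (1 / 2) * scalarCurv g x * symPart g x i j + Lam * symPart g x i j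
        - (c.v' + c.w) * (3 * tau g i j x - (1 / 2) * torsionSq g x * symPart g x i j)) * h x i j))
      (volume.restrict D) :=
    hint (hvolc.mul (continuousOn_finsetSum Finset.univ fun i _ =>
      continuousOn_finsetSum Finset.univ fun j _ =>
      ((((hc (hgc.ricci i j)).sub ((continuousOn_const.mul (hc hgc.scalarCurv)).mul
        (hc (hgc.symPart i j)))).add (continuousOn_const.mul (hc (hgc.symPart i j)))).sub
        (continuousOn_const.mul ((continuousOn_const.mul (hc (hgc.tau i j))).sub
          ((continuousOn_const.mul (hc hgc.torsionSq)).mul (hc (hgc.symPart i j)))))).mul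
        (hhc i j)))
  have hi2 : ∀ k, Integrable (fun x => pd k (palatiniField γ k) x) (volume.restrict D) :=
    fun k => hint (contDiffOn_pd hU (hXs k)).continuousOn
  have hi3 : Integrable (fun x => volDensity g x *
      torsionPair (gInv g x) (T' x) (torsionLow g x)) (volume.restrict D) := by
    have hT'c : ∀ i j k, ContinuousOn (fun x => T' x i j k) U := fun i j k =>
      (((hγ.torsionLow i j k).contDiffOn_sdot hOo).mono hUO).continuousOn
    simp only [torsionPair]
    exact hint (hvolc.mul (continuousOn_finsetSum _ fun c _ => continuousOn_finsetSum _ fun d _ =>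
      continuousOn_finsetSum _ fun a _ => continuousOn_finsetSum _ fun e _ =>
      continuousOn_finsetSum _ fun b _ => continuousOn_finsetSum _ fun z _ =>
      ((((hc (hgc.gInv c d)).mul (hc (hgc.gInv a e))).mul (hc (hgc.gInv b z))).mul
        (hT'c e c b)).mul (hc (hgc.torsionLow z d a))))
  have hi4 : Integrable (fun x => volDensity g x * ∑ i, ∑ j, W x i j * h x i j)
      (volume.restrict D) :=
    hint (hvolc.mul (continuousOn_finsetSum Finset.univ fun i _ =>
      continuousOn_finsetSum Finset.univ fun j _ => (hW.cont i j).mul (hhc i j)))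
  refine key.congr_deriv ?_
  rw [integral_sub (hi1.fun_add (integrable_finsetSum _ fun k _ => hi2 k)) (hi3.const_mul _),
    integral_add hi1 (integrable_finsetSum _ fun k _ => hi2 k),
    integral_finsetSum _ fun k _ => hi2 k, integral_const_mul, hTW]
  simp only [hdiv, Finset.sum_const_zero, add_zero]
  rw [← integral_const_mul, ← integral_sub hi1 (hi4.const_mul _)]
  refine integral_congr_ae (Filter.Eventually.of_forall fun x => ?_)
  have hterm : ∑ i, ∑ j, (einsteinLam g Lam i j x - torsionStress c g W x i j) * h x i j =
      ∑ i, ∑ j, (ricci g i j x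
        - (1 / 2) * scalarCurv g x * symPart g x i j + Lam * symPart g x i j
        - (c.v' + c.w) * (3 * tau g i j x - (1 / 2) * torsionSq g x * symPart g x i j)) * h x i j
      - 2 * (c.v' + c.w) * ∑ i, ∑ j, W x i j * h x i j := by
    simp only [Finset.mul_sum]
    rw [← Finset.sum_sub_distrib]
    refine Finset.sum_congr rfl fun i _ => ?_
    rw [← Finset.sum_sub_distrib]
    refine Finset.sum_congr rfl fun j _ => ?_
    simp only [einsteinLam, torsionStress, Matrix.of_apply]
    ring
  simp only [hterm]
  ring

end ActionVariation

/-! ### Symmetry of the Ricci tensor -/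

section RicciSymmetry

variable {U : Set Coord} {g : Field2} {x : Coord}

theorem pd_pd_comm {f : Coord → ℝ} (hU : IsOpen U) (hf : ContDiffOn ℝ ∞ f U) (hx : x ∈ U)
    (i j : Fin 4) : pd i (pd j f) x = pd j (pd i f) x := by
  have hfx : ContDiffAt ℝ ∞ f x := hf.contDiffAt (hU.mem_nhds hx)
  have hdf : DifferentiableAt ℝ (fderiv ℝ f) x :=
    (hfx.fderiv_right (m := 1) (by norm_cast)).differentiableAt (by norm_num)
  have happ : ∀ i j, pd i (pd j f) x =
      fderiv ℝ (fderiv ℝ f) x (Pi.single i 1) (Pi.single j 1) := by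
    intro i j
    change fderiv ℝ (fun y => fderiv ℝ f y (Pi.single j 1)) x (Pi.single i 1) = _
    rw [fderiv_clm_apply hdf (differentiableAt_const _)]
    simp
  have hsymm := hfx.isSymmSndFDerivAt (by
    rw [minSmoothness_of_isRCLikeNormedField]; exact WithTop.coe_le_coe.mpr le_top)
  rw [happ, happ]
  exact hsymm _ _

theorem volDensity_ne_zero (hx : (symPart g x).det ≠ 0) : volDensity g x ≠ 0 :=
  (Real.sqrt_pos.mpr (abs_pos.mpr hx)).ne'

/-- The Ricci tensor is symmetric because `Γ^a_{ia}` is the logarithmic gradient of the volume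
density. -/
theorem ricci_symm (hU : IsOpen U) (hg : ∀ i j, ContDiffOn ℝ ∞ (fun x => g x i j) U)
    (hdet : ∀ x ∈ U, (symPart g x).det ≠ 0) (hx : x ∈ U) (i j : Fin 4) :
    ricci g i j x = ricci g j i x := by
  have hgc := smoothMetricFamily_const hU hg hdet
  have hvol : ContDiffOn ℝ ∞ (volDensity g) U := hgc.volDensity.slice 0
  have hΓ : ∀ i j k, DifferentiableAt ℝ (christoffelSym g i j k) x := fun i j k =>
    differentiableAt_of_contDiffOn hU ((hgc.christoffelSym i j k).slice 0) hx
  set L : Fin 4 → Coord → ℝ := fun i y => ∑ a, christoffelSym g a i a y with hL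
  have hLd : ∀ i, DifferentiableAt ℝ (L i) x := fun i =>
    DifferentiableAt.fun_sum fun a _ => hΓ a i a
  have hgrad : ∀ i, EqOn (pd i (volDensity g)) (fun y => volDensity g y * L i y) U := by
    intro i y hy
    rw [pd_volDensity (hdet y hy) (fun a b => differentiableAt_of_contDiffOn hU (hg a b) hy)
      (differentiableAt_of_contDiffOn hU hvol hy)]
    simp only [hL, fun a => christoffelSym_symm g a i a y]
  have hsecond : ∀ i j, pd j (pd i (volDensity g)) x =
      volDensity g x * L j x * L i x + volDensity g x * pd j (L i) x := by
    intro i j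
    rw [pd_congr ((hgrad i).eventuallyEq_of_mem (hU.mem_nhds hx)),
      pd_mul (differentiableAt_of_contDiffOn hU hvol hx) (hLd i), hgrad j hx]
  -- symmetry of the second derivatives of the volume density
  have hcurl : pd j (L i) x = pd i (L j) x := by
    have h1 := pd_pd_comm hU hvol hx i j
    rw [hsecond, hsecond] at h1
    refine mul_left_cancel₀ (volDensity_ne_zero (hdet x hx)) ?_
    linarith
  have hric : ∀ i j, ricci g i j x = (∑ a, pd a (christoffelSym g a i j) x) - pd j (L i) x
      + (∑ a, ∑ b, christoffelSym g b i j x * christoffelSym g a b a x)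
      - ∑ a, ∑ b, christoffelSym g b i a x * christoffelSym g a b j x := fun i j => by
    simp only [hL, pd_sum fun a => hΓ a i a]
    simp only [ricci, riemann, Finset.sum_add_distrib, Finset.sum_sub_distrib]
  have h1 : ∀ a, christoffelSym g a i j = christoffelSym g a j i := fun a =>
    funext fun y => christoffelSym_symm g a i j y
  have h2 : ∑ a, ∑ b, christoffelSym g b i a x * christoffelSym g a b j x =
      ∑ a, ∑ b, christoffelSym g b j a x * christoffelSym g a b i x := by
    rw [Finset.sum_comm]
    refine Finset.sum_congr rfl fun a _ => Finset.sum_congr rfl fun b _ => ?_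
    rw [christoffelSym_symm g a i b, christoffelSym_symm g b a j, mul_comm]
  rw [hric, hric, hcurl, h2]
  simp only [h1]

end RicciSymmetry

/-! ### The fundamental lemma of the calculus of variations -/

section FundamentalLemma

variable {U : Set Coord} {g : Field2}

/-- The fundamental lemma of the calculus of variations for symmetric fields, tested against
admissible variations. -/
theorem eq_zero_of_integral_variation_eq_zero (hU : IsOpen U)
    (hg : ∀ i j, ContDiffOn ℝ ∞ (fun x => g x i j) U)
    (hdet : ∀ x ∈ U, (symPart g x).det ≠ 0) {E : Fin 4 → Fin 4 → Coord → ℝ}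
    (hE : ∀ i j, ContinuousOn (E i j) U) (hsymm : ∀ x ∈ U, ∀ i j, E i j x = E j i x)
    (hzero : ∀ (D : Set Coord) (h : Field2), IsCompact D → D ⊆ U → IsVariation D h →
      ∫ x in D, volDensity g x * ∑ i, ∑ j, E i j x * h x i j = 0)
    {x : Coord} (hx : x ∈ U) (i j : Fin 4) : E i j x = 0 := by
  have hvol : ContinuousOn (volDensity g) U :=
    ((smoothMetricFamily_const hU hg hdet).volDensity.slice 0).continuousOn
  set f : Coord → ℝ := fun y => volDensity g y * (E i j y + E j i y) with hf
  have hfc : ContinuousOn f U := hvol.mul ((hE i j).add (hE j i))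
  have hae : ∀ᵐ y ∂(volume : Measure Coord), y ∈ U → f y = 0 := by
    refine hU.ae_eq_zero_of_integral_contDiff_smul_eq_zero
      (hfc.locallyIntegrableOn hU.measurableSet) fun φ hφ hφc hφU => ?_
    -- the test field with the components `φ` in the positions `(i, j)` and `(j, i)`
    set h : Field2 := fun y => φ y • (Matrix.single i j 1 + Matrix.single j i 1) with hh
    have hvar : IsVariation (tsupport φ) h := by
      refine ⟨fun y => ?_, fun a b => ?_, fun y hy => ?_⟩
      · simp only [hh, Matrix.transpose_smul, Matrix.transpose_add, Matrix.transpose_single]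
        rw [add_comm]
      · simp only [hh, Matrix.smul_apply, smul_eq_mul]
        exact hφ.mul contDiff_const
      · simp only [hh, image_eq_zero_of_notMem_tsupport hy, zero_smul]
    have h1 := hzero _ h hφc hφU hvar
    have h2 : ∀ y, volDensity g y * ∑ a, ∑ b, E a b y * h y a b = φ y • f y := by
      intro y
      have h3 : ∀ a b, ∑ p, ∑ q, E p q y * (Matrix.single a b (1 : ℝ)) p q = E a b y := by
        intro a b
        simp only [Matrix.single_apply, ite_and, mul_ite, mul_one, mul_zero]
        simp
      have h4 : ∑ a, ∑ b, E a b y * h y a b = φ y *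
          ((∑ p, ∑ q, E p q y * (Matrix.single i j (1 : ℝ)) p q)
            + ∑ p, ∑ q, E p q y * (Matrix.single j i (1 : ℝ)) p q) := by
        simp only [← Finset.sum_add_distrib, Finset.mul_sum, hh, Matrix.smul_apply,
          Matrix.add_apply, smul_eq_mul]
        refine Finset.sum_congr rfl fun a _ => Finset.sum_congr rfl fun b _ => ?_
        ring
      rw [h4, h3, h3, smul_eq_mul, hf]
      ring
    simp only [h2] at h1
    rw [← h1]
    refine (setIntegral_eq_integral_of_forall_compl_eq_zero fun y hy => ?_).symm
    rw [image_eq_zero_of_notMem_tsupport hy, zero_smul]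
  have hEq : EqOn f (fun _ => 0) U :=
    Measure.eqOn_open_of_ae_eq ((ae_restrict_iff' hU.measurableSet).mpr hae) hU hfc
      continuousOn_const
  have h5 := (mul_eq_zero.mp (hEq hx)).resolve_left (volDensity_ne_zero (hdet x hx))
  rw [hsymm x hx j i] at h5
  linarith

end FundamentalLemma

/-! ### Symmetry, continuity and contractions of the stress tensor -/

section Stress

variable {U : Set Coord} {g W : Field2}

theorem tau_symm (g : Field2) (i j : Fin 4) (x : Coord) : tau g i j x = tau g j i x := by
  have h : ∀ c d, symDelta c d i j = symDelta c d j i := fun c d => by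
    simp only [symDelta]; rw [add_comm]
  simp only [tau, h]

theorem torsionStress_symm {x : Coord} (hW : (W x).transpose = W x) (c : Coeffs) (i j : Fin 4) :
    torsionStress c g W x i j = torsionStress c g W x j i := by
  have h : W x i j = W x j i := by conv_lhs => rw [← hW, Matrix.transpose_apply]
  simp only [torsionStress, Matrix.of_apply, tau_symm g i j, symPart_symm g x i j, h]

theorem continuousOn_torsionStress (hU : IsOpen U)
    (hg : ∀ i j, ContDiffOn ℝ ∞ (fun x => g x i j) U)
    (hdet : ∀ x ∈ U, (symPart g x).det ≠ 0) (hW : ∀ i j, ContinuousOn (fun x => W x i j) U)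
    (c : Coeffs) (i j : Fin 4) : ContinuousOn (fun x => torsionStress c g W x i j) U := by
  have hgc := smoothMetricFamily_const hU hg hdet
  have h1 : ContinuousOn (tau g i j) U := ((hgc.tau i j).slice 0).continuousOn
  have h2 : ContinuousOn (torsionSq g) U := (hgc.torsionSq.slice 0).continuousOn
  have h3 : ContinuousOn (fun x => symPart g x i j) U := ((hgc.symPart i j).slice 0).continuousOn
  exact continuousOn_const.mul (((continuousOn_const.mul h1).add
    (continuousOn_const.mul (hW i j))).sub ((continuousOn_const.mul h2).mul h3))

theorem continuousOn_einsteinLam (hU : IsOpen U)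
    (hg : ∀ i j, ContDiffOn ℝ ∞ (fun x => g x i j) U)
    (hdet : ∀ x ∈ U, (symPart g x).det ≠ 0) (Lam : ℝ) (i j : Fin 4) :
    ContinuousOn (einsteinLam g Lam i j) U := by
  have hgc := smoothMetricFamily_const hU hg hdet
  have h1 : ContinuousOn (ricci g i j) U := ((hgc.ricci i j).slice 0).continuousOn
  have h2 : ContinuousOn (scalarCurv g) U := (hgc.scalarCurv.slice 0).continuousOn
  have h3 : ContinuousOn (fun x => symPart g x i j) U := ((hgc.symPart i j).slice 0).continuousOn
  exact (h1.sub ((continuousOn_const.mul h2).mul h3)).add (continuousOn_const.mul h3)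

theorem trace_symPart {x : Coord} (hx : (symPart g x).det ≠ 0) :
    trace g x (symPart g x) = 4 := by
  have h : trace g x (symPart g x) = (gInv g x * symPart g x).trace := by
    simp only [trace, Matrix.trace, Matrix.diag_apply, Matrix.mul_apply, symPart_symm g x]
  rw [h, gInv_mul_symPart hx, Matrix.trace_one]
  simp

theorem trace_torsionStress {x : Coord} (hx : (symPart g x).det ≠ 0) (c : Coeffs) :
    trace g x (torsionStress c g W x) = (c.v' + c.w) *
      (3 * trace g x (fun i j => tau g i j x) + 2 * trace g x (W x) - 2 * torsionSq g x) := by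
  have h : trace g x (torsionStress c g W x) = (c.v' + c.w) *
      (3 * trace g x (fun i j => tau g i j x) + 2 * trace g x (W x)
        - (1 / 2) * torsionSq g x * trace g x (symPart g x)) := by
    simp only [trace, torsionStress, Matrix.of_apply, Finset.mul_sum]
    simp only [← Finset.sum_add_distrib, ← Finset.sum_sub_distrib, Finset.mul_sum]
    refine Finset.sum_congr rfl fun i _ => Finset.sum_congr rfl fun j _ => ?_
    ring
  rw [h, trace_symPart hx]
  ring

theorem contract_torsionStress (c : Coeffs) (x : Coord) (u : Fin 4 → ℝ) :
    contract (torsionStress c g W x) u = (c.v' + c.w) *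
      (contract (fun i j => 3 * tau g i j x + 2 * W x i j) u
        - (1 / 2) * torsionSq g x * contract (symPart g x) u) := by
  simp only [contract, torsionStress, Matrix.of_apply, Finset.mul_sum]
  simp only [← Finset.sum_sub_distrib, Finset.mul_sum]
  refine Finset.sum_congr rfl fun i _ => Finset.sum_congr rfl fun j _ => ?_
  ring

end Stress

/-! ### The equations of motion and the energy-momentum tensor -/

section EnergyMomentum

variable {U : Set Coord} {g : Field2} {A : Field2 → Field2} {W : Field2}

/-- The equations of motion. -/
theorem isStationary_iff (hU : IsOpen U) (hg : ∀ i j, ContDiffOn ℝ ∞ (fun x => g x i j) U)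
    (hdet : ∀ x ∈ U, (symPart g x).det ≠ 0) (hA : IsSkewRule U g A)
    (hW : IsTorsionVariation U g A W) (c : Coeffs) (Lam : ℝ) :
    IsStationary U g A c Lam ↔
      ∀ x ∈ U, ∀ i j, einsteinLam g Lam i j x = torsionStress c g W x i j := by
  refine ⟨fun hst x hx i j => sub_eq_zero.mp ?_, fun heq D h hD hDU hh => ?_⟩
  · refine eq_zero_of_integral_variation_eq_zero hU hg hdet
      (E := fun i j x => einsteinLam g Lam i j x - torsionStress c g W x i j)
      (fun i j => (continuousOn_einsteinLam hU hg hdet Lam i j).sub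
        (continuousOn_torsionStress hU hg hdet hW.cont c i j)) (fun y hy i j => ?_)
      (fun D h hD hDU hh => ?_) hx i j
    · rw [torsionStress_symm (hW.symm y hy) c i j, einsteinLam, einsteinLam,
        ricci_symm hU hg hdet hy i j, symPart_symm g y i j]
    · exact (hasDerivAt_action hU hg hdet hA hW c Lam hD hDU hh).unique (hst D h hD hDU hh)
  · refine (hasDerivAt_action hU hg hdet hA hW c Lam hD hDU hh).congr_deriv ?_
    rw [← integral_zero Coord ℝ (μ := volume.restrict D)]
    refine setIntegral_congr_fun hD.measurableSet fun x hx => ?_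
    simp only [heq x (hDU hx), sub_self, zero_mul, Finset.sum_const_zero, mul_zero]

/-- Existence and uniqueness of the energy-momentum tensor. -/
theorem isEnergyMomentum_iff (hU : IsOpen U) (hg : ∀ i j, ContDiffOn ℝ ∞ (fun x => g x i j) U)
    (hdet : ∀ x ∈ U, (symPart g x).det ≠ 0) (hA : IsSkewRule U g A)
    (hW : IsTorsionVariation U g A W) (c : Coeffs) (Lam : ℝ) (T : Field2) :
    IsEnergyMomentum U g A c Lam T ↔ EqOn T (torsionStress c g W) U := by
  have hcont := continuousOn_torsionStress hU hg hdet hW.cont c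
  refine ⟨fun hT x hx => ?_, fun hT => ⟨fun x hx => ?_, fun i j => ?_, fun D h hD hDU hh => ?_⟩⟩
  · ext i j
    refine (sub_eq_zero.mp ?_).symm
    refine eq_zero_of_integral_variation_eq_zero hU hg hdet
      (E := fun i j x => torsionStress c g W x i j - T x i j)
      (fun i j => (hcont i j).sub (hT.cont i j)) (fun y hy i j => ?_)
      (fun D h hD hDU hh => ?_) hx i j
    · have h1 : T y i j = T y j i := by conv_lhs => rw [← hT.symm y hy, Matrix.transpose_apply]
      rw [torsionStress_symm (hW.symm y hy) c i j, h1]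
    · have h1 := (hT.deriv D h hD hDU hh).unique
        (hasDerivAt_action hU hg hdet hA hW c Lam hD hDU hh)
      have hvol : ContinuousOn (volDensity g) U :=
        ((smoothMetricFamily_const hU hg hdet).volDensity.slice 0).continuousOn
      have hint : ∀ S : Field2, (∀ i j, ContinuousOn (fun x => S x i j) U) → Integrable
          (fun x => volDensity g x * ∑ i, ∑ j, (einsteinLam g Lam i j x - S x i j) * h x i j)
          (volume.restrict D) := fun S hS =>
        ((hvol.mul (continuousOn_finsetSum Finset.univ fun i _ =>
          continuousOn_finsetSum Finset.univ fun j _ =>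
          ((continuousOn_einsteinLam hU hg hdet Lam i j).sub (hS i j)).mul
            (hh.smooth i j).continuous.continuousOn)).mono hDU).integrableOn_compact hD
      rw [← sub_eq_zero, ← integral_sub (hint T hT.cont) (hint _ hcont)] at h1
      refine Eq.trans (setIntegral_congr_fun hD.measurableSet fun y _ => ?_) h1
      change _ = volDensity g y * _ - volDensity g y * _
      rw [← mul_sub, ← Finset.sum_sub_distrib]
      congr 1
      refine Finset.sum_congr rfl fun i _ => ?_
      rw [← Finset.sum_sub_distrib]
      refine Finset.sum_congr rfl fun j _ => ?_
      ring
  · ext i j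
    rw [Matrix.transpose_apply, hT hx]
    exact torsionStress_symm (hW.symm x hx) c j i
  · exact (hcont i j).congr fun x hx => by rw [hT hx]
  · refine (hasDerivAt_action hU hg hdet hA hW c Lam hD hDU hh).congr_deriv ?_
    refine setIntegral_congr_fun hD.measurableSet fun x hx => ?_
    simp only [hT (hDU hx)]

end EnergyMomentum

/-! ### Pressure, energy-density and state parameter -/

section StateParameters

variable {g T W : Field2} {x : Coord} {c : Coeffs}

theorem trace_pressure_density (hx : (symPart g x).det ≠ 0) (hT : T x = torsionStress c g W x) :
    trace g x (T x) = (c.v' + c.w) * (3 * trace g x (fun i j => tau g i j x)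
      + 2 * trace g x (W x) - 2 * torsionSq g x) ∧
    (∀ u : Fin 4 → ℝ, contract (symPart g x) u = 1 →
      pressure g T u x = -(1 / 3) * (c.v' + c.w) *
        (3 * trace g x (fun i j => tau g i j x) + 2 * trace g x (W x) - (3 / 2) * torsionSq g x
          - contract (fun i j => 3 * tau g i j x + 2 * W x i j) u) ∧
      density T u x = (c.v' + c.w) * (contract (fun i j => 3 * tau g i j x + 2 * W x i j) u
        - (1 / 2) * torsionSq g x)) ∧
    (symPart g x 0 0 = 1 →
      pressure0 g T x = -(1 / 3) * (c.v' + c.w) *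
        (3 * trace g x (fun i j => tau g i j x) + 2 * trace g x (W x) - (3 / 2) * torsionSq g x
          - 3 * tau g 0 0 x - 2 * W x 0 0) ∧
      density0 T x = (c.v' + c.w) * (3 * tau g 0 0 x + 2 * W x 0 0
        - (1 / 2) * torsionSq g x)) := by
  have h00 : torsionStress c g W x 0 0 = (c.v' + c.w) *
      (3 * tau g 0 0 x + 2 * W x 0 0 - (1 / 2) * torsionSq g x * symPart g x 0 0) := rfl
  refine ⟨?_, fun u hu => ⟨?_, ?_⟩, fun hu => ⟨?_, ?_⟩⟩
  · rw [hT, trace_torsionStress hx]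
  · rw [pressure, hT, trace_torsionStress hx, contract_torsionStress, hu]
    ring
  · rw [density, hT, contract_torsionStress, hu]
    ring
  · rw [pressure0, hT, trace_torsionStress hx, h00, hu]
    ring
  · rw [density0, hT, h00, hu]
    ring

end StateParameters

end GenRiem

end

theorem mainTheorem1
    (U : Set GenRiem.Coord) (hU : IsOpen U)
    (g : GenRiem.Field2)
    (hg : ∀ i j, ContDiffOn ℝ ∞ (fun x => g x i j) U)
    (hdet : ∀ x ∈ U, (GenRiem.symPart g x).det ≠ 0)
    (A : GenRiem.Field2 → GenRiem.Field2) (hA : GenRiem.IsSkewRule U g A)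
    (W : GenRiem.Field2) (hW : GenRiem.IsTorsionVariation U g A W) :
    -- the family of scalar curvatures
    (∀ (c : GenRiem.Coeffs), ∀ x ∈ U,
      GenRiem.scalarFamily c g x =
        GenRiem.scalarCurv g x - (c.v' + c.w) * GenRiem.torsionSq g x) ∧
    -- the equations of motion
    (∀ (c : GenRiem.Coeffs) (Lam : ℝ),
      GenRiem.IsStationary U g A c Lam ↔
        ∀ x ∈ U, ∀ i j,
          GenRiem.ricci g i j x
              - (1 / 2) * GenRiem.scalarCurv g x * GenRiem.symPart g x i j
              + Lam * GenRiem.symPart g x i j =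
            (c.v' + c.w) * (3 * GenRiem.tau g i j x + 2 * W x i j
              - (1 / 2) * GenRiem.torsionSq g x * GenRiem.symPart g x i j)) ∧
    -- the energy-momentum tensor that results from the action
    (∀ (c : GenRiem.Coeffs) (Lam : ℝ) (T : GenRiem.Field2),
      GenRiem.IsEnergyMomentum U g A c Lam T ↔
        ∀ x ∈ U, ∀ i j,
          T x i j = (c.v' + c.w) * (3 * GenRiem.tau g i j x + 2 * W x i j
            - (1 / 2) * GenRiem.torsionSq g x * GenRiem.symPart g x i j)) ∧
    -- its trace, the pressures and the energy-densities
    (∀ (c : GenRiem.Coeffs) (Lam : ℝ) (T : GenRiem.Field2),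
      GenRiem.IsEnergyMomentum U g A c Lam T → ∀ x ∈ U,
        GenRiem.trace g x (T x) =
          (c.v' + c.w) * (3 * GenRiem.trace g x (fun i j => GenRiem.tau g i j x)
            + 2 * GenRiem.trace g x (W x) - 2 * GenRiem.torsionSq g x) ∧
        (∀ u : Fin 4 → ℝ, GenRiem.contract (GenRiem.symPart g x) u = 1 →
          GenRiem.pressure g T u x =
            -(1 / 3) * (c.v' + c.w) *
              (3 * GenRiem.trace g x (fun i j => GenRiem.tau g i j x)
                + 2 * GenRiem.trace g x (W x) - (3 / 2) * GenRiem.torsionSq g x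
                - GenRiem.contract (fun i j => 3 * GenRiem.tau g i j x + 2 * W x i j) u) ∧
          GenRiem.density T u x =
            (c.v' + c.w) *
              (GenRiem.contract (fun i j => 3 * GenRiem.tau g i j x + 2 * W x i j) u
                - (1 / 2) * GenRiem.torsionSq g x)) ∧
        (GenRiem.symPart g x 0 0 = 1 →
          GenRiem.pressure0 g T x =
            -(1 / 3) * (c.v' + c.w) *
              (3 * GenRiem.trace g x (fun i j => GenRiem.tau g i j x)
                + 2 * GenRiem.trace g x (W x) - (3 / 2) * GenRiem.torsionSq g x
                - 3 * GenRiem.tau g 0 0 x - 2 * W x 0 0) ∧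
          GenRiem.density0 T x =
            (c.v' + c.w) *
              (3 * GenRiem.tau g 0 0 x + 2 * W x 0 0
                - (1 / 2) * GenRiem.torsionSq g x))) ∧
    -- the state parameters do not depend on the coefficients, wherever they are defined
    (∀ (c₁ c₂ : GenRiem.Coeffs) (Lam₁ Lam₂ : ℝ) (T₁ T₂ : GenRiem.Field2),
      GenRiem.IsEnergyMomentum U g A c₁ Lam₁ T₁ →
      GenRiem.IsEnergyMomentum U g A c₂ Lam₂ T₂ → ∀ x ∈ U,
        (∀ u : Fin 4 → ℝ, GenRiem.contract (GenRiem.symPart g x) u = 1 →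
          GenRiem.density T₁ u x ≠ 0 → GenRiem.density T₂ u x ≠ 0 →
          GenRiem.stateParam g T₁ u x = GenRiem.stateParam g T₂ u x) ∧
        (GenRiem.symPart g x 0 0 = 1 →
          GenRiem.density0 T₁ x ≠ 0 → GenRiem.density0 T₂ x ≠ 0 →
          GenRiem.stateParam0 g T₁ x = GenRiem.stateParam0 g T₂ x)) := by
  have hEM := fun c Lam T => GenRiem.isEnergyMomentum_iff hU hg hdet hA hW c Lam T
  refine ⟨fun c x hx => ?_, fun c Lam => GenRiem.isStationary_iff hU hg hdet hA hW c Lam,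
    fun c Lam T => ?_, fun c Lam T hT x hx =>
      GenRiem.trace_pressure_density (hdet x hx) ((hEM c Lam T).mp hT hx),
    fun c₁ c₂ Lam₁ Lam₂ T₁ T₂ hT₁ hT₂ x hx => ?_⟩
  · exact (GenRiem.smoothMetricFamily_const hU hg hdet).scalarFamily_eq (s := 0) hx c
  · rw [hEM]
    exact ⟨fun h x hx i j => by rw [h hx]; rfl, fun h x hx => Matrix.ext fun i j => h x hx i j⟩
  · obtain ⟨-, h₁, h₁'⟩ :=
      GenRiem.trace_pressure_density (hdet x hx) ((hEM c₁ Lam₁ T₁).mp hT₁ hx)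
    obtain ⟨-, h₂, h₂'⟩ :=
      GenRiem.trace_pressure_density (hdet x hx) ((hEM c₂ Lam₂ T₂).mp hT₂ hx)
    -- the common factor `v' + w` cancels from the ratio of pressure and energy-density
    have hratio : ∀ k₁ k₂ a b : ℝ, k₁ * b ≠ 0 → k₂ * b ≠ 0 →
        -(1 / 3) * k₁ * a * (k₁ * b)⁻¹ = -(1 / 3) * k₂ * a * (k₂ * b)⁻¹ := by
      intro k₁ k₂ a b h₁ h₂
      have hk₁ := left_ne_zero_of_mul h₁
      have hk₂ := left_ne_zero_of_mul h₂
      have hb := right_ne_zero_of_mul h₁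
      field_simp
    refine ⟨fun u hu hρ₁ hρ₂ => ?_, fun hu hρ₁ hρ₂ => ?_⟩
    · rw [(h₁ u hu).2] at hρ₁
      rw [(h₂ u hu).2] at hρ₂
      rw [GenRiem.stateParam, GenRiem.stateParam, (h₁ u hu).1, (h₁ u hu).2, (h₂ u hu).1,
        (h₂ u hu).2]
      exact hratio _ _ _ _ hρ₁ hρ₂
    · rw [(h₁' hu).2] at hρ₁
      rw [(h₂' hu).2] at hρ₂
      rw [GenRiem.stateParam0, GenRiem.stateParam0, (h₁' hu).1, (h₁' hu).2, (h₂' hu).1,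
        (h₂' hu).2]
      exact hratio _ _ _ _ hρ₁ hρ₂
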